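/- **Setting and conventions.** For each integer $n\le 0$ let $A_n\subset\mathbb R$ be a Borel set, and let $(X_n)_{n\le 0}$, $X_n\in A_n$, be a Markov process on a probability space with given transition kernels $P_n$ from $A_{n-1}$ to $A_n$: for every $n\le 0$ and every Borel set $E\subset A_n$, $\mathbb P(X_n\in E\mid \mathcal F_{n-1})=P_n(X_{n-1},E)$ a.s., where $\mathcal F_n=\sigma(X_m;\,m\le n)$. No stationarity or time-homogeneity is assumed. Let $\mathcal F=(\mathcal F_n)_{n\le 0}$ and $\mathcal F_{-\infty}=\bigcap_{n\le 0}\mathcal F_n$. The process is *monotonic* if for all $n\le 0$ and all $x\le x'$ in $A_{n-1}$ there is a coupling $(Y,Y')$ of $P_n(x,\cdot)$ and $P_n(x',\cdot)$ with $Y\le Y'$ a.s.; it is *identifiable* if $x\mapsto P_n(x,\cdot)$ is one-to-one on $A_{n-1}$ for every $n\le 0$. Inclusions between $\sigma$-fields are understood up to negligible sets. A *copy* of $(X_n)$ is a process $(X'_n)_{n\le 0}$, on any probability space, with the same law; its generated filtration is denoted $\mathcal F'$, and a filtration isomorphic to $\mathcal F$ means such an $\mathcal F'$. * A filtration $\mathcal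 G$ is of *product type* if it is generated by a sequence of independent random variables. A filtration $\mathcal F'$ is *immersed* in $\mathcal G$ if $\mathcal F'_n\subset\mathcal G_n$ for all $n\le 0$ and, for all $n<0$, $\mathcal F'_{n+1}$ and $\mathcal G_n$ are conditionally independent given $\mathcal F'_n$. $\mathcal F$ is *standard* if the filtration of some copy of $(X_n)$ is immersed in a filtration of product type. * A *parameterization* of a filtration $\mathcal F'$ is a sequence $(U_n)_{n\le 0}$ of random variables, with values in arbitrary measurable spaces, such that for all $n\le 0$, $U_n$ is independent of $\mathcal F'_{n-1}\vee\sigma(U_m;\,m\le n-1)$ and $\mathcal F'_n\subset\mathcal F'_{n-1}\vee\sigma(U_n)$. It is *generating* if $\mathcal F'_n\subset\sigma(U_m;\,m\le n)$ for all $n\le 0$. * An *increasing representation* of $(X_n)$ consists of a copy $(X'_n)$ of $(X_n)$, a parameterization $(U_n)$ of its filtration $\mathcal F'$, and jointly measurable functions $f_n$ with values in $A_n$ such that $X'_n=f_n(X'_{n-1},U_n)$ a.s., $f_n(x,U_n)$ has law $P_n(x,\cdot)$ for every $x\in A_{n-1}$, and $f_n(x,U_n)\le f_n(x',U_n)$ a.s.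 for each pair $x\le x'$ in $A_{n-1}$, for all $n\le 0$. * $\mathcal F$ is *Kolmogorovian* if every event of $\mathcal F_{-\infty}$ has probability $0$ or $1$. **Theorem.** Let $(X_n)_{n\le 0}$ be monotonic. 1) The following conditions are equivalent: (a) $\mathcal F$ is standard; (b) up to isomorphism, $\mathcal F$ admits a generating parameterization, i.e. the filtration of some copy of $(X_n)$ has one; (c) for every increasing representation $(X'_n),(f_n,U_n)$ of $(X_n)$, $(U_n)$ is a generating parameterization of $\mathcal F'$; (d) for every $n\le 0$, the conditional law $\mathcal L(X_n\mid\mathcal F_{-\infty})$ is a.s. equal to $\mathcal L(X_n)$; (e) $\mathcal F$ is Kolmogorovian. 2) If moreover the process is identifiable, then these five conditions are equivalent to the a.s. equality $\mathcal L(X_0\mid\mathcal F_{-\infty})=\mathcal L(X_0)$. -/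

import Mathlib

open MeasureTheory ProbabilityTheory

universe u v w

/- Time convention: processes and filtrations are indexed by nonpositive integers.  The index
`k : ℕ` stands for the time `-k`; thus `k + 1` is the instant just before `k`, and the past of
the instant `k` consists of the indices `j ≥ k`. -/

namespace NegTime

/-- The filtration generated by a process: at time `-k` it is the `σ`-field generated by all the
`Z j` with `j ≥ k`, that is, by the process up to time `-k`. -/
@[reducible] def natFiltration {Ω : Type*} {E : ℕ → Type*} [∀ k, MeasurableSpace (E k)]
    (Z : ∀ k, Ω → E k) (k : ℕ) : MeasurableSpace Ω :=
  ⨆ (j : ℕ) (_ : k ≤ j), MeasurableSpace.comap (Z j) inferInstance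

/-- The tail `σ`-field of a filtration in negative time. -/
@[reducible] def tail {Ω : Type*} (F : ℕ → MeasurableSpace Ω) : MeasurableSpace Ω :=
  ⨅ k, F k

/-- A filtration is Kolmogorovian when its tail `σ`-field is degenerate. -/
def IsKolmogorovian {Ω : Type*} (F : ℕ → MeasurableSpace Ω) [MeasurableSpace Ω]
    (μ : Measure Ω) : Prop :=
  ∀ s, MeasurableSet[tail F] s → μ s = 0 ∨ μ s = 1

/-- Inclusion of `σ`-fields up to negligible sets. -/
def AELE {Ω : Type*} (m₁ m₂ : MeasurableSpace Ω) {mΩ : MeasurableSpace Ω} (μ : Measure Ω) : Prop :=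
  ∀ s, MeasurableSet[m₁] s → ∃ t, MeasurableSet[m₂] t ∧ s =ᵐ[μ] t

/-- Conditional independence of the `σ`-fields `m₁` and `m₂` given `m'` (stated with conditional
probabilities of events, on an arbitrary probability space). -/
def CondIndepSigma {Ω : Type*} (m' m₁ m₂ : MeasurableSpace Ω) {mΩ : MeasurableSpace Ω}
    (μ : Measure Ω) : Prop :=
  ∀ s t, MeasurableSet[m₁] s → MeasurableSet[m₂] t →
    μ[(s ∩ t).indicator (fun _ => (1 : ℝ)) | m'] =ᵐ[μ]
      μ[s.indicator (fun _ => (1 : ℝ)) | m'] * μ[t.indicator (fun _ => (1 : ℝ)) | m']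

/-- The filtration `F` is immersed in the filtration `G`. -/
structure IsImmersed {Ω : Type*} (F G : ℕ → MeasurableSpace Ω) {mΩ : MeasurableSpace Ω}
    (μ : Measure Ω) : Prop where
  le : ∀ k, AELE (F k) (G k) μ
  condIndep : ∀ k, CondIndepSigma (F (k + 1)) (F k) (G (k + 1)) μ

/-- A filtration of product type: it is generated by a sequence of independent random variables
(with values in arbitrary measurable spaces). -/
def IsProductType.{a, b} {Ω : Type a} (G : ℕ → MeasurableSpace Ω) {mΩ : MeasurableSpace Ω}
    (μ : Measure Ω) : Prop :=
  ∃ (E : ℕ → Type b) (_ : ∀ k, MeasurableSpace (E k)) (ε : ∀ k, Ω → E k),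
    (∀ k, Measurable (ε k)) ∧ iIndepFun ε μ ∧ G = natFiltration ε

/-- `X'` (on `(Ω', μ')`) is a copy of the process `X` (on `(Ω, μ)`): it has the same law. -/
structure IsCopy {Ω Ω' : Type*} [MeasurableSpace Ω] [MeasurableSpace Ω'] {α : ℕ → Type*}
    [∀ k, MeasurableSpace (α k)] (X' : ∀ k, Ω' → α k) (μ' : Measure Ω')
    (X : ∀ k, Ω → α k) (μ : Measure Ω) : Prop where
  measurable : ∀ k, Measurable (X' k)
  identDistrib : IdentDistrib (fun ω k => X' k ω) (fun ω k => X k ω) μ' μ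

/-- The filtration generated by `X` is standard: up to isomorphism, i.e. after replacing `X` by a
copy on some probability space, it is immersed in a filtration of product type. -/
def IsStandard.{a, b, c} {Ω : Type a} [MeasurableSpace Ω] {α : ℕ → Type c}
    [∀ k, MeasurableSpace (α k)] (X : ∀ k, Ω → α k) (μ : Measure Ω) : Prop :=
  ∃ (Ω' : Type b) (_ : MeasurableSpace Ω') (μ' : Measure Ω') (_ : IsProbabilityMeasure μ')
    (X' : ∀ k, Ω' → α k) (G : ℕ → MeasurableSpace Ω'),
    IsCopy X' μ' X μ ∧ IsProductType.{b, b} G μ' ∧ IsImmersed (natFiltration X') G μ'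

/-- `U` is a parameterization of the filtration `F`.  (The variables `U k` are then mutually
independent.) -/
structure IsParameterization {Ω : Type*} (F : ℕ → MeasurableSpace Ω) {mΩ : MeasurableSpace Ω}
    {E : ℕ → Type*} [∀ k, MeasurableSpace (E k)] (U : ∀ k, Ω → E k) (μ : Measure Ω) : Prop where
  measurable : ∀ k, Measurable (U k)
  indep : ∀ k, Indep (MeasurableSpace.comap (U k) inferInstance)
    (F (k + 1) ⊔ natFiltration U (k + 1)) μ
  le : ∀ k, AELE (F k) (F (k + 1) ⊔ MeasurableSpace.comap (U k) inferInstance) μ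

/-- `U` is a generating parameterization of the filtration `F`. -/
structure IsGeneratingParameterization {Ω : Type*} (F : ℕ → MeasurableSpace Ω)
    {mΩ : MeasurableSpace Ω} {E : ℕ → Type*} [∀ k, MeasurableSpace (E k)]
    (U : ∀ k, Ω → E k) (μ : Measure Ω) : Prop extends IsParameterization F U μ where
  generating : ∀ k, AELE (F k) (natFiltration U k) μ

/-- The filtration generated by `X` admits, up to isomorphism, a generating parameterization. -/
def AdmitsGeneratingParameterization.{a, b, c} {Ω : Type a} [MeasurableSpace Ω]
    {α : ℕ → Type c} [∀ k, MeasurableSpace (α k)] (X : ∀ k, Ω → α k) (μ : Measure Ω) : Prop :=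
  ∃ (Ω' : Type b) (_ : MeasurableSpace Ω') (μ' : Measure Ω') (_ : IsProbabilityMeasure μ')
    (X' : ∀ k, Ω' → α k) (E : ℕ → Type b) (_ : ∀ k, MeasurableSpace (E k)) (U : ∀ k, Ω' → E k),
    IsCopy X' μ' X μ ∧ IsGeneratingParameterization (natFiltration X') U μ'

/-- `X` is a Markov process whose transition from the instant `k + 1` to the next instant `k` is
given by the Markov kernel `P k`. -/
structure IsMarkovProcess {Ω : Type*} [MeasurableSpace Ω] {α : ℕ → Type*}
    [∀ k, MeasurableSpace (α k)] (X : ∀ k, Ω → α k) (P : ∀ k, Kernel (α (k + 1)) (α k))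
    (μ : Measure Ω) : Prop where
  measurable : ∀ k, Measurable (X k)
  isMarkovKernel : ∀ k, IsMarkovKernel (P k)
  transition : ∀ k (B : Set (α k)), MeasurableSet B →
    μ[(X k ⁻¹' B).indicator (fun _ => (1 : ℝ)) | natFiltration X (k + 1)] =ᵐ[μ]
      fun ω => (P k (X (k + 1) ω)).real B

/-- Stochastic domination: there is a coupling of `μ` and `ν` which is ordered almost surely. -/
def StochLE {β : Type*} [MeasurableSpace β] [LE β] (μ ν : Measure β) : Prop :=
  ∃ π : Measure (β × β), π.map Prod.fst = μ ∧ π.map Prod.snd = ν ∧ ∀ᵐ p ∂π, p.1 ≤ p.2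

/-- Increasing kernels. -/
def IsIncreasingKernel {β γ : Type*} [MeasurableSpace β] [LE β] [MeasurableSpace γ] [LE γ]
    (κ : Kernel β γ) : Prop :=
  ∀ x x', x ≤ x' → StochLE (κ x) (κ x')

/-- Identifiable kernels. -/
def IsIdentifiableKernel {β γ : Type*} [MeasurableSpace β] [MeasurableSpace γ]
    (κ : Kernel β γ) : Prop :=
  Function.Injective fun x => κ x

/-- `(f, U)` is an increasing representation of the process `X` with transition kernels `P`:
`U` is a parameterization of the filtration of `X`, each `f k` is an increasing updating function
of `P k` with respect to the law of `U k`, and `X k = f k (X (k + 1)) (U k)` almost surely. -/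
structure IsIncreasingRepresentation {Ω : Type*} [MeasurableSpace Ω] {α : ℕ → Type*}
    [∀ k, MeasurableSpace (α k)] [∀ k, LE (α k)] {E : ℕ → Type*} [∀ k, MeasurableSpace (E k)]
    (X : ∀ k, Ω → α k) (P : ∀ k, Kernel (α (k + 1)) (α k))
    (f : ∀ k, α (k + 1) → E k → α k) (U : ∀ k, Ω → E k) (μ : Measure Ω) : Prop where
  parameterization : IsParameterization (natFiltration X) U μ
  measurable : ∀ k, Measurable (Function.uncurry (f k))
  updating : ∀ k x, (μ.map (U k)).map (f k x) = P k x
  increasing : ∀ k x x', x ≤ x' → ∀ᵐ ω ∂μ, f k x (U k ω) ≤ f k x' (U k ω)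
  eq : ∀ k, ∀ᵐ ω ∂μ, X k ω = f k (X (k + 1) ω) (U k ω)

/-- Every increasing representation of (a copy of) `X` provides a generating parameterization of
the filtration generated by that copy. -/
def EveryIncreasingRepresentationGenerates.{a, b, c} {Ω : Type a} [MeasurableSpace Ω]
    {α : ℕ → Type c} [∀ k, MeasurableSpace (α k)] [∀ k, LE (α k)] (X : ∀ k, Ω → α k)
    (P : ∀ k, Kernel (α (k + 1)) (α k)) (μ : Measure Ω) : Prop :=
  ∀ (Ω' : Type b) (_ : MeasurableSpace Ω') (μ' : Measure Ω') (_ : IsProbabilityMeasure μ')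
    (X' : ∀ k, Ω' → α k) (E : ℕ → Type b) (_ : ∀ k, MeasurableSpace (E k))
    (f : ∀ k, α (k + 1) → E k → α k) (U : ∀ k, Ω' → E k),
    IsCopy X' μ' X μ → IsIncreasingRepresentation X' P f U μ' →
      IsGeneratingParameterization (natFiltration X') U μ'

/-- The (regular) conditional law of the real random variable `Y` given the `σ`-field `m`. -/
noncomputable def condLaw {Ω : Type*} (m : MeasurableSpace Ω) {mΩ : MeasurableSpace Ω}
    (Y : Ω → ℝ) (μ : Measure Ω) [IsFiniteMeasure μ] : @Kernel Ω ℝ m Real.measurableSpace :=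
  @condDistrib Ω Ω ℝ _ _ _ mΩ m Y id μ _

end NegTime

/-!
The heart of the matter is a coupling argument for
`NegTime.IsIncreasingRepresentation.aele_comap_of_tendsto`.  In an increasing representation the
state `X k` is the value at `X (k + j)` of a flow (`NegTime.flow`) which depends only on the `j`
innovations in between, and which is independent of `X (k + j)`.  The flow preserves the order, and
two states of the line are always comparable.  Hence, for a bounded increasing function `g`, the
mean distance between the values of `g` at the images of `x` and `x'` under the flow is just
`|T g x - T g x'|`, where `T g (X (k + j)) = E[g (X k) | F (k + j)]`.  By reverse martingale
convergence (`NegTime.tendsto_lintegral_condExp_sub_const`, proved in `L²` with orthogonal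
projections), if `g (X k)` has constant conditional expectation given the tail `σ`-field, then
`T g (X (k + j))` converges in mean to this constant.  Starting the flow from a well chosen
deterministic state, one therefore approximates `g (X k)` in mean by functions of finitely many
innovations.  If `g` is strictly increasing, then `X k` itself is a function of the innovations.

When the tail does not affect the law of any `X k`, this applies with the sigmoid function at each
instant.  When only the law of `X 0` is known not to be affected but the kernels are identifiable,
it applies with the functions `NegTime.predictor`, defined by `ψ (k + 1) x = ∫ ψ k d(P k x)`: they
are strictly increasing, because two ordered laws which give the same mean to a strictly increasing
function are equal, and `E[ψ k (X k) | tail]` does not depend on `k`.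

The condition on increasing representations is of use because there is at least one
(`NegTime.IsMarkovProcess.exists_isIncreasingRepresentation`).  The updating functions are the
quantile functions of the kernels.  As the process has no initial instant, it cannot be built from
its innovations; instead, one takes a copy of the process and samples the innovations afterwards,
from their conditional law given the transitions.

The remaining implications are soft: a generating parameterization is a sequence of independent
variables in whose filtration the process is immersed; a filtration contained in one of product type
is Kolmogorovian by the zero-one law; and a degenerate tail `σ`-field is independent of every `X k`.
-/

open Filter Topology

namespace NegTime

/-! ### Joins of `σ`-fields, independence, and inclusions up to negligible sets -/

section SigmaFields

variable {Ω : Type*}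

/-- The `π`-system of the sets `a ∩ b` with `a ∈ m₁` and `b ∈ m₂`; it generates `m₁ ⊔ m₂`. -/
def interSets (m₁ m₂ : MeasurableSpace Ω) : Set (Set Ω) :=
  {s | ∃ a b, MeasurableSet[m₁] a ∧ MeasurableSet[m₂] b ∧ s = a ∩ b}

lemma isPiSystem_interSets (m₁ m₂ : MeasurableSpace Ω) : IsPiSystem (interSets m₁ m₂) := by
  rintro _ ⟨a, b, ha, hb, rfl⟩ _ ⟨a', b', ha', hb', rfl⟩ -
  exact ⟨a ∩ a', b ∩ b', MeasurableSet.inter ha ha', MeasurableSet.inter hb hb',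
    Set.inter_inter_inter_comm _ _ _ _⟩

lemma generateFrom_interSets (m₁ m₂ : MeasurableSpace Ω) :
    MeasurableSpace.generateFrom (interSets m₁ m₂) = m₁ ⊔ m₂ := by
  apply le_antisymm
  · refine MeasurableSpace.generateFrom_le ?_
    rintro _ ⟨a, b, ha, hb, rfl⟩
    exact MeasurableSet.inter ((le_sup_left : m₁ ≤ m₁ ⊔ m₂) _ ha)
      ((le_sup_right : m₂ ≤ m₁ ⊔ m₂) _ hb)
  · refine sup_le (fun a ha => ?_) (fun b hb => ?_)
    · exact MeasurableSpace.measurableSet_generateFrom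
        ⟨a, Set.univ, ha, MeasurableSet.univ, by simp⟩
    · exact MeasurableSpace.measurableSet_generateFrom
        ⟨Set.univ, b, MeasurableSet.univ, hb, by simp⟩

lemma indep_sup_left {m₁ m₂ m₃ : MeasurableSpace Ω} {mΩ : MeasurableSpace Ω} {μ : Measure Ω}
    [IsProbabilityMeasure μ] (h₁ : m₁ ≤ mΩ) (h₂ : m₂ ≤ mΩ) (h₃ : m₃ ≤ mΩ)
    (h : Indep m₁ (m₂ ⊔ m₃) μ) (h' : Indep m₂ m₃ μ) : Indep (m₁ ⊔ m₂) m₃ μ := by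
  refine IndepSets.indep (sup_le h₁ h₂) h₃ (isPiSystem_interSets m₁ m₂)
    (@MeasurableSpace.isPiSystem_measurableSet Ω m₃) (generateFrom_interSets m₁ m₂).symm
    (@MeasurableSpace.generateFrom_measurableSet Ω m₃).symm ?_
  rw [IndepSets_iff]
  rintro _ c ⟨a, b, ha, hb, rfl⟩ hc
  rw [Indep_iff] at h h'
  have hbc : MeasurableSet[m₂ ⊔ m₃] (b ∩ c) :=
    MeasurableSet.inter ((le_sup_left : m₂ ≤ m₂ ⊔ m₃) _ hb) ((le_sup_right : m₃ ≤ m₂ ⊔ m₃) _ hc)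
  rw [Set.inter_assoc, h a _ ha hbc, h' b c hb hc,
    h a b ha ((le_sup_left : m₂ ≤ m₂ ⊔ m₃) _ hb), mul_assoc]

lemma aele_iff {m₁ m₂ : MeasurableSpace Ω} {mΩ : MeasurableSpace Ω} {μ : Measure Ω} :
    AELE m₁ m₂ μ ↔ m₁ ≤ eventuallyMeasurableSpace m₂ (ae μ) := Iff.rfl

lemma aele_of_le {m₁ m₂ : MeasurableSpace Ω} {mΩ : MeasurableSpace Ω} (μ : Measure Ω)
    (h : m₁ ≤ m₂) : AELE m₁ m₂ μ :=
  fun s hs => ⟨s, h s hs, EventuallyEq.rfl⟩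

lemma AELE.mono_right {m₁ m₂ m₃ : MeasurableSpace Ω} {mΩ : MeasurableSpace Ω} {μ : Measure Ω}
    (h : AELE m₁ m₂ μ) (h' : m₂ ≤ m₃) : AELE m₁ m₃ μ := fun s hs =>
  let ⟨t, ht, hst⟩ := h s hs
  ⟨t, h' t ht, hst⟩

lemma aele_comap_of_ae_eq {E : Type*} [mE : MeasurableSpace E] {m : MeasurableSpace Ω}
    {mΩ : MeasurableSpace Ω} {μ : Measure Ω} {Y Z : Ω → E} (hZ : Measurable[m] Z)
    (h : Y =ᵐ[μ] Z) : AELE (MeasurableSpace.comap Y mE) m μ := by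
  rintro _ ⟨B, hB, rfl⟩
  exact ⟨Z ⁻¹' B, hZ hB, h.preimage B⟩

end SigmaFields

/-! ### The filtration generated by a process -/

section NatFiltration

variable {Ω : Type*} {E : ℕ → Type*} [∀ k, MeasurableSpace (E k)] (Z : ∀ k, Ω → E k)

/-- The past of a process up to time `-k`, as a single random sequence. -/
def past (k : ℕ) (ω : Ω) : ∀ i, E (k + i) := fun i => Z (k + i) ω

lemma comap_le_natFiltration {k j : ℕ} (h : k ≤ j) :
    MeasurableSpace.comap (Z j) inferInstance ≤ natFiltration Z k :=
  le_iSup₂ (f := fun j (_ : k ≤ j) => MeasurableSpace.comap (Z j) inferInstance) j h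

lemma measurable_natFiltration {k j : ℕ} (h : k ≤ j) : Measurable[natFiltration Z k] (Z j) :=
  measurable_iff_comap_le.2 (comap_le_natFiltration Z h)

lemma natFiltration_antitone : Antitone (natFiltration Z) := fun _ _ h =>
  iSup₂_le fun _ hj => comap_le_natFiltration Z (h.trans hj)

lemma natFiltration_le [mΩ : MeasurableSpace Ω] (hZ : ∀ k, Measurable (Z k)) (k : ℕ) :
    natFiltration Z k ≤ mΩ :=
  iSup₂_le fun j _ => (hZ j).comap_le

lemma natFiltration_eq_sup (k : ℕ) :
    natFiltration Z k =
      natFiltration Z (k + 1) ⊔ MeasurableSpace.comap (Z k) inferInstance := by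
  apply le_antisymm
  · refine iSup₂_le fun j hj => ?_
    rcases hj.eq_or_lt with rfl | hj
    · exact le_sup_right
    · exact (comap_le_natFiltration Z hj).trans le_sup_left
  · exact sup_le (natFiltration_antitone Z k.le_succ) (comap_le_natFiltration Z le_rfl)

lemma natFiltration_eq_comap_past (k : ℕ) :
    natFiltration Z k = MeasurableSpace.comap (past Z k) MeasurableSpace.pi := by
  apply le_antisymm
  · refine iSup₂_le fun j hj => ?_
    obtain ⟨i, rfl⟩ := Nat.exists_eq_add_of_le hj
    rw [← measurable_iff_comap_le]
    exact (measurable_pi_apply i).comp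
      (measurable_iff_comap_le.2 le_rfl :
        Measurable[MeasurableSpace.comap (past Z k) MeasurableSpace.pi] (past Z k))
  · rw [← measurable_iff_comap_le]
    exact @measurable_pi_lambda _ _ _ (natFiltration Z k) _ _
      fun i => measurable_natFiltration Z (Nat.le_add_right k i)

lemma measurable_past [MeasurableSpace Ω] (hZ : ∀ k, Measurable (Z k)) (k : ℕ) :
    Measurable (past Z k) :=
  measurable_pi_lambda _ fun i => hZ (k + i)

lemma tail_le [mΩ : MeasurableSpace Ω] (hZ : ∀ k, Measurable (Z k)) :
    tail (natFiltration Z) ≤ mΩ :=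
  (iInf_le _ 0).trans (natFiltration_le Z hZ 0)

lemma aele_natFiltration [MeasurableSpace Ω] {μ : Measure Ω} {G : ℕ → MeasurableSpace Ω}
    (hG : Antitone G)
    (h : ∀ k, AELE (MeasurableSpace.comap (Z k) inferInstance) (G k) μ) (k : ℕ) :
    AELE (natFiltration Z k) (G k) μ := by
  rw [aele_iff]
  exact iSup₂_le fun j hj => aele_iff.1 ((h j).mono_right (hG hj))

end NatFiltration

lemma IsParameterization.iIndepFun {Ω : Type*} {F : ℕ → MeasurableSpace Ω}
    {mΩ : MeasurableSpace Ω} {E : ℕ → Type*} [∀ k, MeasurableSpace (E k)] {U : ∀ k, Ω → E k}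
    {μ : Measure Ω} [IsProbabilityMeasure μ] (h : IsParameterization F U μ) : iIndepFun U μ := by
  rw [iIndepFun_iff]
  intro S
  induction S using Finset.induction_on_min with
  | empty => simp
  | insert a S ha ih =>
    intro t ht
    -- `a` is the latest instant of the family, and `U a` is independent of the earlier innovations
    have haS : a ∉ S := fun h => (ha a h).false
    rw [Finset.set_biInter_insert, Finset.prod_insert haS,
      ← ih fun i hi => ht i (Finset.mem_insert_of_mem hi)]
    have hmeas : MeasurableSet[natFiltration U (a + 1)] (⋂ i ∈ S, t i) :=
      @Finset.measurableSet_biInter _ _ (natFiltration U (a + 1)) _ S fun i hi =>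
        comap_le_natFiltration U (ha i hi) _ (ht i (Finset.mem_insert_of_mem hi))
    exact (Indep_iff _ _ _).1 (h.indep a) _ _ (ht a (Finset.mem_insert_self a S))
      ((le_sup_right : natFiltration U (a + 1) ≤ F (a + 1) ⊔ natFiltration U (a + 1)) _ hmeas)

end NegTime

/-! ### Reverse martingale convergence in mean -/

/-- Orthogonal projections on a decreasing sequence of closed subspaces converge to zero on the
orthogonal complement of the intersection. -/
lemma Submodule.tendsto_starProjection_zero_of_antitone {H : Type*} [NormedAddCommGroup H]
    [InnerProductSpace ℝ H] [CompleteSpace H] (K : ℕ → Submodule ℝ H)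
    [∀ k, (K k).HasOrthogonalProjection] (hK : Antitone K) {x : H} (hx : x ∈ (⨅ k, K k)ᗮ) :
    Tendsto (fun k => (K k).starProjection x) atTop (𝓝 0) := by
  have hmono : Monotone fun k => (K k)ᗮ := fun i j h => Submodule.orthogonal_le (hK h)
  have hlim := Submodule.starProjection_tendsto_closure_iSup (fun k => (K k)ᗮ) hmono x
  have hmem : x ∈ (⨆ k, (K k)ᗮ).topologicalClosure := by
    rw [← Submodule.orthogonal_orthogonal_eq_closure, ← Submodule.iInf_orthogonal]
    simpa only [Submodule.orthogonal_orthogonal] using hx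
  rw [Submodule.starProjection_eq_self_iff.2 hmem] at hlim
  simpa [Submodule.starProjection_orthogonal_val] using hlim.const_sub x

namespace NegTime

section Tail

variable {Ω : Type*} {F : ℕ → MeasurableSpace Ω} {mΩ : MeasurableSpace Ω} {μ : Measure Ω}

/-- A set which belongs to each term of a decreasing filtration up to negligible sets belongs to
the tail `σ`-field up to negligible sets. -/
lemma exists_measurableSet_tail (hF : Antitone F) {s : Set Ω} {t : ℕ → Set Ω}
    (ht : ∀ k, MeasurableSet[F k] (t k)) (hst : ∀ k, s =ᵐ[μ] t k) :
    ∃ T, MeasurableSet[tail F] T ∧ s =ᵐ[μ] T := by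
  refine ⟨limsup t atTop, ?_, ?_⟩
  · refine MeasurableSpace.measurableSet_iInf.2 fun k => ?_
    rw [← limsup_nat_add t k]
    exact @MeasurableSet.measurableSet_limsup _ (F k) _ fun n =>
      hF (Nat.le_add_left k n) _ (ht (n + k))
  · have h : ∀ᵐ ω ∂μ, ∀ k, ω ∈ s ↔ ω ∈ t k := ae_all_iff.2 fun k => (hst k).mem_iff
    refine eventuallyEq_set.2 ?_
    filter_upwards [h] with ω hω
    rw [mem_limsup_iff_frequently_mem]
    simp [← hω]

lemma aestronglyMeasurable_tail (hF : Antitone F) {f : Ω → ℝ}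
    (hf : ∀ k, AEStronglyMeasurable[F k] f μ) : AEStronglyMeasurable[tail F] f μ := by
  choose g hg hfg using hf
  refine ⟨fun ω => limsup (fun k => g k ω) atTop, ?_, ?_⟩
  · have hmeas : Measurable[tail F] fun ω => limsup (fun k => g k ω) atTop := by
      intro B hB
      refine MeasurableSpace.measurableSet_iInf.2 fun k => ?_
      have hk : (fun ω => limsup (fun k => g k ω) atTop)
          = fun ω => limsup (fun n => g (n + k) ω) atTop :=
        funext fun ω => (limsup_nat_add (fun n => g n ω) k).symm
      rw [hk]
      exact (@Measurable.limsup _ _ _ _ _ (F k) _ _ _ _ fun n =>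
        ((hg (n + k)).mono (hF (Nat.le_add_left k n))).measurable) hB
    exact hmeas.stronglyMeasurable
  · have h : ∀ᵐ ω ∂μ, ∀ k, f ω = g k ω := ae_all_iff.2 hfg
    filter_upwards [h] with ω hω
    simp [← hω]

/-- Reverse martingale convergence, for a square integrable variable whose conditional expectation
given the tail `σ`-field vanishes. -/
lemma tendsto_lintegral_condExp_of_condExp_tail_eq_zero [IsProbabilityMeasure μ]
    (hF : Antitone F) (hle : ∀ k, F k ≤ mΩ) {g : Ω → ℝ} (hg : MemLp g 2 μ)
    (h0 : μ[g | tail F] =ᵐ[μ] 0) :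
    Tendsto (fun k => ∫⁻ ω, ‖(μ[g | F k]) ω‖ₑ ∂μ) atTop (𝓝 0) := by
  have htail : tail F ≤ mΩ := (iInf_le _ 0).trans (hle 0)
  let K : ℕ → Submodule ℝ (Lp ℝ 2 μ) := fun k => lpMeas ℝ ℝ (F k) 2 μ
  -- these instances make each `lpMeas` a closed subspace with an orthogonal projection
  have hfact : ∀ k, Fact (F k ≤ mΩ) := fun k => ⟨hle k⟩
  have hproj : ∀ k, (K k).HasOrthogonalProjection := fun k => by
    dsimp only [K]; infer_instance
  have hK : Antitone K := fun i j hij f hf => by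
    rw [mem_lpMeas_iff_aestronglyMeasurable] at hf ⊢
    exact hf.mono (hF hij)
  have horth : hg.toLp g ∈ (⨅ k, K k)ᗮ := by
    rw [Submodule.mem_orthogonal]
    intro f hf
    have hfm : AEStronglyMeasurable[tail F] f μ := aestronglyMeasurable_tail hF fun k =>
      mem_lpMeas_iff_aestronglyMeasurable.1 ((Submodule.mem_iInf K).1 hf k)
    have hgi : Integrable g μ := hg.integrable (by norm_num)
    have hfg : Integrable (g * (f : Ω → ℝ)) μ := hg.integrable_mul (Lp.memLp f)
    rw [L2.inner_def]
    calc ∫ ω, inner ℝ (f ω) (hg.toLp g ω) ∂μ = ∫ ω, (g * (f : Ω → ℝ)) ω ∂μ := by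
          refine integral_congr_ae ?_
          filter_upwards [hg.coeFn_toLp] with ω hω
          simp [hω]
      _ = ∫ ω, (μ[g * (f : Ω → ℝ) | tail F]) ω ∂μ := (integral_condExp htail).symm
      _ = 0 := by
          rw [integral_congr_ae (condExp_mul_of_aestronglyMeasurable_right hfm hfg hgi)]
          refine integral_eq_zero_of_ae ?_
          filter_upwards [h0] with ω hω
          simp [hω]
  have hlim := Submodule.tendsto_starProjection_zero_of_antitone K hK horth
  rw [Lp.tendsto_Lp_iff_tendsto_eLpNorm'] at hlim
  refine tendsto_of_tendsto_of_tendsto_of_le_of_le tendsto_const_nhds hlim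
    (fun _ => zero_le) fun k => ?_
  have hae : ((K k).starProjection (hg.toLp g) : Ω → ℝ) =ᵐ[μ] μ[g | F k] :=
    hg.condExpL2_ae_eq_condExp (𝕜 := ℝ) (hle k)
  have hae' : (((K k).starProjection (hg.toLp g) : Ω → ℝ) - ((0 : Lp ℝ 2 μ) : Ω → ℝ)) =ᵐ[μ]
      μ[g | F k] := by
    filter_upwards [hae, Lp.coeFn_zero ℝ 2 μ] with ω hω hω0
    rw [Pi.sub_apply, hω, hω0]
    simp
  simp only [eLpNorm_congr_ae hae']
  rw [← eLpNorm_one_eq_lintegral_enorm]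
  exact eLpNorm_le_eLpNorm_of_exponent_le (by norm_num)
    (stronglyMeasurable_condExp.mono (hle k)).aestronglyMeasurable

lemma tendsto_lintegral_condExp_sub_const [IsProbabilityMeasure μ]
    (hF : Antitone F) (hle : ∀ k, F k ≤ mΩ) {g : Ω → ℝ} (hg : MemLp g 2 μ) {c : ℝ}
    (hc : μ[g | tail F] =ᵐ[μ] fun _ => c) :
    Tendsto (fun k => ∫⁻ ω, ‖(μ[g | F k]) ω - c‖ₑ ∂μ) atTop (𝓝 0) := by
  have hgi : Integrable g μ := hg.integrable (by norm_num)
  have hsub : ∀ m ≤ mΩ, μ[g - fun _ => c | m] =ᵐ[μ] fun ω => (μ[g | m]) ω - c := fun m hm => by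
    filter_upwards [condExp_sub hgi (integrable_const c) m] with ω hω
    rw [hω, condExp_const hm]
    rfl
  have htail : tail F ≤ mΩ := (iInf_le _ 0).trans (hle 0)
  have h := tendsto_lintegral_condExp_of_condExp_tail_eq_zero hF hle (hg.sub (memLp_const c)) (by
    filter_upwards [hsub _ htail, hc] with ω h₁ h₂
    rw [h₁, h₂]
    simp)
  refine h.congr fun k => lintegral_congr_ae ?_
  filter_upwards [hsub _ (hle k)] with ω hω
  rw [hω]

end Tail

/-! ### The Markov property and the transition operators -/

section Markov

variable {Ω : Type*} [mΩ : MeasurableSpace Ω] {α : ℕ → Type*} [∀ k, MeasurableSpace (α k)]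
  {X : ∀ k, Ω → α k} {P : ∀ k, Kernel (α (k + 1)) (α k)} {μ : Measure Ω}

/-- The transition kernel `P k`, seen as a kernel from the past at the instant `k + 1`. -/
noncomputable def pastKernel (P : ∀ k, Kernel (α (k + 1)) (α k)) (k : ℕ) :
    Kernel (∀ i, α (k + 1 + i)) (α k) :=
  (P k).comap (fun z => z 0) (measurable_pi_apply 0)

instance [∀ k, IsMarkovKernel (P k)] (k : ℕ) : IsMarkovKernel (pastKernel P k) := by
  unfold pastKernel; infer_instance

lemma pastKernel_past {Ω' : Type*} (Y : ∀ k, Ω' → α k) (k : ℕ) (ω : Ω') :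
    pastKernel P k (past Y (k + 1) ω) = P k (Y (k + 1) ω) :=
  rfl

lemma IsMarkovProcess.map_past_prodMk [IsProbabilityMeasure μ] (hX : IsMarkovProcess X P μ)
    (k : ℕ) :
    μ.map (fun ω => (past X (k + 1) ω, X k ω)) = μ.map (past X (k + 1)) ⊗ₘ pastKernel P k := by
  have := hX.isMarkovKernel
  have hpast := measurable_past X hX.measurable (k + 1)
  have hm := hpast.prodMk (hX.measurable k)
  have : IsProbabilityMeasure (μ.map (past X (k + 1))) :=
    Measure.isProbabilityMeasure_map hpast.aemeasurable
  refine Measure.ext_prod fun {C B} hC hB => ?_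
  have hle := natFiltration_le X hX.measurable (k + 1)
  have hCmeas : MeasurableSet[natFiltration X (k + 1)] (past X (k + 1) ⁻¹' C) := by
    rw [natFiltration_eq_comap_past]
    exact ⟨C, hC, rfl⟩
  rw [Measure.compProd_apply_prod hC hB, Measure.map_apply hm (hC.prod hB),
    setLIntegral_map hC ((pastKernel P k).measurable_coe hB) hpast]
  have hint : Integrable ((X k ⁻¹' B).indicator (fun _ => (1 : ℝ))) μ :=
    (integrable_const 1).indicator (hX.measurable k hB)
  have h := setIntegral_condExp hle hint hCmeas
  rw [setIntegral_congr_ae (hpast hC) ((hX.transition k B hB).mono fun ω hω _ => hω),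
    setIntegral_indicator (hX.measurable k hB)] at h
  have h' : ∫⁻ ω in past X (k + 1) ⁻¹' C, pastKernel P k (past X (k + 1) ω) B ∂μ
      = ENNReal.ofReal (∫ ω in past X (k + 1) ⁻¹' C, (P k (X (k + 1) ω)).real B ∂μ) := by
    rw [ofReal_integral_eq_lintegral_ofReal]
    · refine lintegral_congr fun ω => ?_
      rw [pastKernel_past, ofReal_measureReal]
    · refine Integrable.of_bound ?_ 1 (ae_of_all _ fun ω => ?_)
      · exact (((P k).measurable_coe hB).comp
          (hX.measurable (k + 1))).ennreal_toReal.aestronglyMeasurable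
      · rw [Real.norm_of_nonneg measureReal_nonneg]
        exact measureReal_le_one
    · exact ae_of_all _ fun _ => measureReal_nonneg
  rw [h', h]
  simp [Set.mk_preimage_prod]

/-- The conditional expectation operator of a Markov process over `j` steps: it sends the function
`g` of the state at the instant `k` to a function of the state at the earlier instant `k + j`. -/
noncomputable def transitionOp (P : ∀ k, Kernel (α (k + 1)) (α k)) (k : ℕ) :
    ∀ j, (α k → ℝ) → α (k + j) → ℝ
  | 0, g => g
  | j + 1, g => fun x => ∫ y, transitionOp P k j g y ∂(P (k + j) x)

lemma measurable_integral_kernel {β γ : Type*} [MeasurableSpace β] [MeasurableSpace γ]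
    (κ : Kernel β γ) [IsMarkovKernel κ] {g : γ → ℝ} (hg : Measurable g) :
    Measurable fun x => ∫ y, g y ∂κ x :=
  (hg.stronglyMeasurable.integral_kernel (κ := κ)).measurable

lemma abs_integral_le_of_bound {γ : Type*} [MeasurableSpace γ] (ν : Measure γ)
    [IsProbabilityMeasure ν] {g : γ → ℝ} {C : ℝ} (hC : ∀ y, |g y| ≤ C) : |∫ y, g y ∂ν| ≤ C := by
  simpa using norm_integral_le_of_norm_le_const (μ := ν) (f := g) (C := C) (ae_of_all _ hC)

lemma integrable_of_measurable_bound {γ : Type*} [MeasurableSpace γ] (ν : Measure γ)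
    [IsFiniteMeasure ν] {g : γ → ℝ} (hg : Measurable g) {C : ℝ} (hC : ∀ y, |g y| ≤ C) :
    Integrable g ν :=
  Integrable.of_bound hg.aestronglyMeasurable C (ae_of_all _ hC)

lemma measurable_transitionOp [∀ k, IsMarkovKernel (P k)] {k : ℕ} {g : α k → ℝ}
    (hg : Measurable g) (j : ℕ) : Measurable (transitionOp P k j g) := by
  induction j with
  | zero => exact hg
  | succ j ih => exact measurable_integral_kernel (P (k + j)) ih

lemma abs_transitionOp_le [∀ k, IsMarkovKernel (P k)] {k : ℕ} {g : α k → ℝ} {C : ℝ}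
    (hC : ∀ y, |g y| ≤ C) (j : ℕ) (x : α (k + j)) : |transitionOp P k j g x| ≤ C := by
  induction j with
  | zero => exact hC x
  | succ j ih => exact abs_integral_le_of_bound _ ih

variable [∀ k, StandardBorelSpace (α k)]

lemma IsMarkovProcess.condExp_comp [IsProbabilityMeasure μ] (hX : IsMarkovProcess X P μ) (k : ℕ)
    {g : α k → ℝ} (hg : Measurable g) {C : ℝ} (hC : ∀ y, |g y| ≤ C) :
    μ[fun ω => g (X k ω) | natFiltration X (k + 1)]
      =ᵐ[μ] fun ω => ∫ y, g y ∂(P k (X (k + 1) ω)) := by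
  have := hX.isMarkovKernel
  have hne : Nonempty (α k) := by
    obtain ⟨ω⟩ := nonempty_of_isProbabilityMeasure μ
    exact ⟨X k ω⟩
  have hpast := measurable_past X hX.measurable (k + 1)
  have h := condExp_ae_eq_integral_condDistrib hpast (hX.measurable k).aemeasurable
    hg.stronglyMeasurable (integrable_of_measurable_bound μ (hg.comp (hX.measurable k))
      fun ω => hC (X k ω))
  have h' := ae_of_ae_map hpast.aemeasurable (condDistrib_ae_eq_of_measure_eq_compProd
    (past X (k + 1)) (hX.measurable k).aemeasurable (hX.map_past_prodMk k))
  rw [natFiltration_eq_comap_past]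
  filter_upwards [h, h'] with ω h₁ h₂
  rw [h₁, h₂, pastKernel_past]

lemma IsMarkovProcess.condExp_transitionOp [IsProbabilityMeasure μ] (hX : IsMarkovProcess X P μ)
    (k : ℕ) {g : α k → ℝ} (hg : Measurable g) {C : ℝ} (hC : ∀ y, |g y| ≤ C) (j : ℕ) :
    μ[fun ω => g (X k ω) | natFiltration X (k + j)]
      =ᵐ[μ] fun ω => transitionOp P k j g (X (k + j) ω) := by
  have := hX.isMarkovKernel
  have hle := natFiltration_le X hX.measurable
  induction j with
  | zero =>
    refine Eq.eventuallyEq (condExp_of_stronglyMeasurable (hle k) ?_ ?_)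
    · exact (hg.comp (measurable_natFiltration X le_rfl)).stronglyMeasurable
    · exact integrable_of_measurable_bound μ (hg.comp (hX.measurable k)) fun ω => hC (X k ω)
  | succ j ih =>
    calc μ[fun ω => g (X k ω) | natFiltration X (k + (j + 1))]
        =ᵐ[μ] μ[μ[fun ω => g (X k ω) | natFiltration X (k + j)] |
            natFiltration X (k + (j + 1))] :=
          (condExp_condExp_of_le (natFiltration_antitone X (k + j).le_succ) (hle (k + j))).symm
      _ =ᵐ[μ] μ[fun ω => transitionOp P k j g (X (k + j) ω) | natFiltration X (k + (j + 1))] :=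
          condExp_congr_ae ih
      _ =ᵐ[μ] fun ω => transitionOp P k (j + 1) g (X (k + (j + 1)) ω) :=
          hX.condExp_comp (k + j) (measurable_transitionOp hg j) (abs_transitionOp_le hC j)

end Markov

/-! ### Stochastic order and increasing kernels -/

section Order

variable {β γ : Type*} [MeasurableSpace β] [LinearOrder β] [MeasurableSpace γ] [LinearOrder γ]

lemma StochLE.integral_le {μ ν : Measure γ} [IsProbabilityMeasure μ] (h : StochLE μ ν)
    {g : γ → ℝ} (hg : Measurable g) (hmono : Monotone g) {C : ℝ} (hC : ∀ y, |g y| ≤ C) :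
    ∫ y, g y ∂μ ≤ ∫ y, g y ∂ν := by
  obtain ⟨π, rfl, rfl, hπ⟩ := h
  have : IsProbabilityMeasure π :=
    Measure.isProbabilityMeasure_of_map Prod.fst
  rw [integral_map measurable_fst.aemeasurable hg.aestronglyMeasurable,
    integral_map measurable_snd.aemeasurable hg.aestronglyMeasurable]
  exact integral_mono_ae
    (integrable_of_measurable_bound π (hg.comp measurable_fst) fun p => hC p.1)
    (integrable_of_measurable_bound π (hg.comp measurable_snd) fun p => hC p.2)
    (hπ.mono fun p hp => hmono hp)

/-- Two stochastically ordered laws which give the same integral to a bounded strictly increasing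
function are equal. -/
lemma StochLE.eq_of_integral_eq {μ ν : Measure γ} [IsProbabilityMeasure μ] (h : StochLE μ ν)
    {g : γ → ℝ} (hg : Measurable g) (hmono : StrictMono g) {C : ℝ} (hC : ∀ y, |g y| ≤ C)
    (heq : ∫ y, g y ∂μ = ∫ y, g y ∂ν) : μ = ν := by
  obtain ⟨π, rfl, rfl, hπ⟩ := h
  have : IsProbabilityMeasure π :=
    Measure.isProbabilityMeasure_of_map Prod.fst
  rw [integral_map measurable_fst.aemeasurable hg.aestronglyMeasurable,
    integral_map measurable_snd.aemeasurable hg.aestronglyMeasurable] at heq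
  -- the two components of the coupling are ordered and have the same mean image under `g`
  have h := (integral_eq_iff_of_ae_le
    (integrable_of_measurable_bound π (hg.comp measurable_fst) fun p => hC p.1)
    (integrable_of_measurable_bound π (hg.comp measurable_snd) fun p => hC p.2)
    (hπ.mono fun p hp => hmono.monotone hp)).1 heq
  exact Measure.map_congr (h.mono fun p hp => hmono.injective hp)

lemma IsIncreasingKernel.monotone_integral {κ : Kernel β γ} [IsMarkovKernel κ]
    (hκ : IsIncreasingKernel κ) {g : γ → ℝ} (hg : Measurable g) (hmono : Monotone g) {C : ℝ}
    (hC : ∀ y, |g y| ≤ C) : Monotone fun x => ∫ y, g y ∂κ x :=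
  fun x x' h => (hκ x x' h).integral_le hg hmono hC

lemma IsIncreasingKernel.strictMono_integral {κ : Kernel β γ} [IsMarkovKernel κ]
    (hκ : IsIncreasingKernel κ) (hid : IsIdentifiableKernel κ) {g : γ → ℝ} (hg : Measurable g)
    (hmono : StrictMono g) {C : ℝ} (hC : ∀ y, |g y| ≤ C) :
    StrictMono fun x => ∫ y, g y ∂κ x :=
  (hκ.monotone_integral hg hmono.monotone hC).strictMono_of_injective fun x x' h => by
    rcases le_total x x' with hx | hx
    · exact hid ((hκ x x' hx).eq_of_integral_eq hg hmono hC h)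
    · exact (hid ((hκ x' x hx).eq_of_integral_eq hg hmono hC h.symm)).symm

end Order

/-! ### The flow of an increasing representation -/

section Flow

variable {Ω : Type*} [mΩ : MeasurableSpace Ω] {α : ℕ → Type*} [∀ k, MeasurableSpace (α k)]
  {E : ℕ → Type*} [∀ k, MeasurableSpace (E k)] {X : ∀ k, Ω → α k} {U : ∀ k, Ω → E k}
  {P : ∀ k, Kernel (α (k + 1)) (α k)} {f : ∀ k, α (k + 1) → E k → α k} {μ : Measure Ω}

/-- The innovations which drive the process from the instant `k + j` to the later instant `k`. -/
def block {Ω : Type*} {E : ℕ → Type*} (U : ∀ k, Ω → E k) (k j : ℕ) (ω : Ω) :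
    ∀ i : Fin j, E (k + i) :=
  fun i => U (k + i) ω

/-- The flow of the updating functions `f`: the state at the instant `k`, as a function of the
state at the earlier instant `k + j` and of the innovations in between.  The recursion removes the
earliest innovation. -/
def flow {α E : ℕ → Type*} (f : ∀ k, α (k + 1) → E k → α k) (k : ℕ) :
    ∀ j, α (k + j) → (∀ i : Fin j, E (k + i)) → α k
  | 0, x, _ => x
  | j + 1, x, u => flow f k j (f (k + j) x (u (Fin.last j))) fun i => u i.castSucc

lemma flow_block_succ {Ω : Type*} {α E : ℕ → Type*} (f : ∀ k, α (k + 1) → E k → α k)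
    (U : ∀ k, Ω → E k) (k j : ℕ) (x : α (k + (j + 1))) (ω : Ω) :
    flow f k (j + 1) x (block U k (j + 1) ω)
      = flow f k j (f (k + j) x (U (k + j) ω)) (block U k j ω) :=
  rfl

lemma measurable_flow (hf : ∀ k, Measurable (Function.uncurry (f k))) (k j : ℕ) :
    Measurable (Function.uncurry (flow f k j)) := by
  induction j with
  | zero => exact measurable_fst
  | succ j ih =>
    have h₁ : Measurable fun p : α (k + (j + 1)) × (∀ i : Fin (j + 1), E (k + i)) =>
        f (k + j) p.1 (p.2 (Fin.last j)) :=
      (hf (k + j)).comp (measurable_fst.prodMk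
        ((measurable_pi_apply (Fin.last j)).comp measurable_snd))
    have h₂ : Measurable fun p : α (k + (j + 1)) × (∀ i : Fin (j + 1), E (k + i)) =>
        (fun i => p.2 i.castSucc : ∀ i : Fin j, E (k + i)) :=
      measurable_pi_lambda _ fun i => (measurable_pi_apply (Fin.castSucc i)).comp measurable_snd
    exact ih.comp (h₁.prodMk h₂)

lemma measurable_block_natFiltration {Ω : Type*} (U : ∀ k, Ω → E k) (k j : ℕ) :
    Measurable[natFiltration U k] (block U k j) :=
  @measurable_pi_lambda _ _ _ (natFiltration U k) _ _
    fun i => measurable_natFiltration U (Nat.le_add_right k i)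

lemma measurable_block (hU : ∀ k, Measurable (U k)) (k j : ℕ) : Measurable (block U k j) :=
  measurable_pi_lambda _ fun i => hU (k + i)

lemma comap_block_succ_le {Ω : Type*} (U : ∀ k, Ω → E k) (k j : ℕ) :
    MeasurableSpace.comap (block U k (j + 1)) MeasurableSpace.pi ≤
      MeasurableSpace.comap (block U k j) MeasurableSpace.pi ⊔
        MeasurableSpace.comap (U (k + j)) inferInstance := by
  rw [← measurable_iff_comap_le]
  refine @measurable_pi_lambda _ _ _ (MeasurableSpace.comap (block U k j) MeasurableSpace.pi ⊔
        MeasurableSpace.comap (U (k + j)) inferInstance) _ _ fun i => ?_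
  induction i using Fin.lastCases with
  | last => exact measurable_iff_comap_le.2 le_sup_right
  | cast i =>
    refine Measurable.mono ?_ le_sup_left le_rfl
    exact (measurable_pi_apply i).comp (comap_measurable (block U k j))

lemma IsParameterization.indep_block [IsProbabilityMeasure μ]
    (h : IsParameterization (natFiltration X) U μ) (hX : ∀ k, Measurable (X k)) (k j : ℕ) :
    Indep (MeasurableSpace.comap (block U k j) MeasurableSpace.pi)
      (natFiltration X (k + j) ⊔ natFiltration U (k + j)) μ := by
  induction j with
  | zero =>
    refine indep_of_indep_of_le_left (indep_bot_left _) ?_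
    rw [← measurable_iff_comap_le]
    exact @measurable_of_subsingleton_codomain _ _ ⊥ _ _ _
  | succ j ih =>
    have hpast : MeasurableSpace.comap (U (k + j)) inferInstance ⊔
        (natFiltration X (k + (j + 1)) ⊔ natFiltration U (k + (j + 1))) ≤
          natFiltration X (k + j) ⊔ natFiltration U (k + j) :=
      sup_le ((comap_le_natFiltration U le_rfl).trans le_sup_right)
        (sup_le_sup (natFiltration_antitone X (k + j).le_succ)
          (natFiltration_antitone U (k + j).le_succ))
    exact indep_of_indep_of_le_left
      (indep_sup_left (measurable_block h.measurable k j).comap_le (h.measurable _).comap_le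
        (sup_le (natFiltration_le X hX _) (natFiltration_le U h.measurable _))
        (indep_of_indep_of_le_right ih hpast) (h.indep (k + j)))
      (comap_block_succ_le U k j)

lemma IsParameterization.map_innovation_prodMk_block [IsProbabilityMeasure μ]
    (h : IsParameterization (natFiltration X) U μ) (hX : ∀ k, Measurable (X k)) (k j : ℕ) :
    μ.map (fun ω => (U (k + j) ω, block U k j ω)) =
      (μ.map (U (k + j))).prod (μ.map (block U k j)) := by
  refine (indepFun_iff_map_prod_eq_prod_map_map (h.measurable _).aemeasurable
    (measurable_block h.measurable k j).aemeasurable).1 ?_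
  rw [IndepFun_iff_Indep]
  exact (indep_of_indep_of_le_right (h.indep_block hX k j)
    ((comap_le_natFiltration U le_rfl).trans le_sup_right)).symm

lemma IsParameterization.map_state_prodMk_block [IsProbabilityMeasure μ]
    (h : IsParameterization (natFiltration X) U μ) (hX : ∀ k, Measurable (X k)) (k j : ℕ) :
    μ.map (fun ω => (X (k + j) ω, block U k j ω)) =
      (μ.map (X (k + j))).prod (μ.map (block U k j)) := by
  refine (indepFun_iff_map_prod_eq_prod_map_map (hX _).aemeasurable
    (measurable_block h.measurable k j).aemeasurable).1 ?_
  rw [IndepFun_iff_Indep]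
  exact (indep_of_indep_of_le_right (h.indep_block hX k j)
    ((comap_le_natFiltration X le_rfl).trans le_sup_left)).symm

end Flow

section Coupling

variable {Ω : Type*} [mΩ : MeasurableSpace Ω] {α : ℕ → Type*} [∀ k, MeasurableSpace (α k)]
  [∀ k, LinearOrder (α k)] {E : ℕ → Type*} [∀ k, MeasurableSpace (E k)]
  {X : ∀ k, Ω → α k} {U : ∀ k, Ω → E k} {P : ∀ k, Kernel (α (k + 1)) (α k)}
  {f : ∀ k, α (k + 1) → E k → α k} {μ : Measure Ω}

lemma IsIncreasingRepresentation.eq_flow (h : IsIncreasingRepresentation X P f U μ) (k j : ℕ) :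
    ∀ᵐ ω ∂μ, X k ω = flow f k j (X (k + j) ω) (block U k j ω) := by
  induction j with
  | zero => exact ae_of_all _ fun _ => rfl
  | succ j ih =>
    filter_upwards [ih, h.eq (k + j)] with ω h₁ h₂
    rw [flow_block_succ, h₁]
    exact congrArg (fun x => flow f k j x (block U k j ω)) h₂

variable [IsProbabilityMeasure μ]

lemma IsIncreasingRepresentation.integral_flow [∀ k, IsMarkovKernel (P k)]
    (h : IsIncreasingRepresentation X P f U μ) (hX : ∀ k, Measurable (X k)) (k : ℕ)
    {g : α k → ℝ} (hg : Measurable g) {C : ℝ} (hC : ∀ y, |g y| ≤ C) (j : ℕ) (x : α (k + j)) :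
    ∫ b, g (flow f k j x b) ∂(μ.map (block U k j)) = transitionOp P k j g x := by
  have hU := h.parameterization.measurable
  have hprob : ∀ i, IsProbabilityMeasure (μ.map (block U k i)) := fun i =>
    Measure.isProbabilityMeasure_map (measurable_block hU k i).aemeasurable
  induction j with
  | zero => simp [flow, transitionOp]
  | succ j ih =>
    have : IsProbabilityMeasure (μ.map (U (k + j))) :=
      Measure.isProbabilityMeasure_map (hU (k + j)).aemeasurable
    have hfx : Measurable (f (k + j) x) := (h.measurable (k + j)).comp measurable_prodMk_left
    have hflow : Measurable fun p : E (k + j) × (∀ i : Fin j, E (k + i)) =>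
        g (flow f k j (f (k + j) x p.1) p.2) :=
      hg.comp ((measurable_flow h.measurable k j).comp
        ((hfx.comp measurable_fst).prodMk measurable_snd))
    calc ∫ b, g (flow f k (j + 1) x b) ∂(μ.map (block U k (j + 1)))
        = ∫ ω, g (flow f k j (f (k + j) x (U (k + j) ω)) (block U k j ω)) ∂μ := by
          rw [integral_map (measurable_block hU k (j + 1)).aemeasurable]
          · rfl
          · exact (hg.comp ((measurable_flow h.measurable k (j + 1)).comp
              measurable_prodMk_left)).aestronglyMeasurable
      _ = ∫ p, g (flow f k j (f (k + j) x p.1) p.2)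
            ∂((μ.map (U (k + j))).prod (μ.map (block U k j))) := by
          rw [← h.parameterization.map_innovation_prodMk_block hX k j,
            integral_map ((hU _).prodMk (measurable_block hU k j)).aemeasurable
              hflow.aestronglyMeasurable]
      _ = ∫ u, ∫ b, g (flow f k j (f (k + j) x u) b) ∂(μ.map (block U k j))
            ∂(μ.map (U (k + j))) :=
          integral_prod _ (integrable_of_measurable_bound _ hflow fun p => hC _)
      _ = ∫ u, transitionOp P k j g (f (k + j) x u) ∂(μ.map (U (k + j))) := by simp_rw [ih]
      _ = transitionOp P k (j + 1) g x := by
          change _ = ∫ y, transitionOp P k j g y ∂(P (k + j) x)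
          rw [← h.updating (k + j) x, integral_map hfx.aemeasurable
            (measurable_transitionOp hg j).aestronglyMeasurable]

variable [∀ k, TopologicalSpace (α k)] [∀ k, OrderClosedTopology (α k)]
  [∀ k, SecondCountableTopology (α k)] [∀ k, OpensMeasurableSpace (α k)]

lemma IsIncreasingRepresentation.flow_le (h : IsIncreasingRepresentation X P f U μ)
    (hX : ∀ k, Measurable (X k)) (k j : ℕ) {x x' : α (k + j)} (hx : x ≤ x') :
    ∀ᵐ b ∂(μ.map (block U k j)), flow f k j x b ≤ flow f k j x' b := by
  have hU := h.parameterization.measurable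
  have hprob : ∀ i, IsProbabilityMeasure (μ.map (block U k i)) := fun i =>
    Measure.isProbabilityMeasure_map (measurable_block hU k i).aemeasurable
  induction j with
  | zero => exact ae_of_all _ fun _ => hx
  | succ j ih =>
    have : IsProbabilityMeasure (μ.map (U (k + j))) :=
      Measure.isProbabilityMeasure_map (hU (k + j)).aemeasurable
    have hfx : ∀ x, Measurable (f (k + j) x) := fun x =>
      (h.measurable (k + j)).comp measurable_prodMk_left
    have hflow : ∀ x, Measurable fun p : E (k + j) × (∀ i : Fin j, E (k + i)) =>
        flow f k j (f (k + j) x p.1) p.2 := fun x =>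
      (measurable_flow h.measurable k j).comp
        (((hfx x).comp measurable_fst).prodMk measurable_snd)
    have hflow' : ∀ x, Measurable fun b => flow f k (j + 1) x b := fun x =>
      (measurable_flow h.measurable k (j + 1)).comp measurable_prodMk_left
    rw [ae_map_iff (measurable_block hU k (j + 1)).aemeasurable
      (measurableSet_le (hflow' x) (hflow' x'))]
    simp only [flow_block_succ]
    have key : ∀ᵐ p ∂((μ.map (U (k + j))).prod (μ.map (block U k j))),
        flow f k j (f (k + j) x p.1) p.2 ≤ flow f k j (f (k + j) x' p.1) p.2 := by
      rw [Measure.ae_prod_iff_ae_ae (measurableSet_le (hflow x) (hflow x'))]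
      have hle : ∀ᵐ u ∂(μ.map (U (k + j))), f (k + j) x u ≤ f (k + j) x' u :=
        (ae_map_iff (hU _).aemeasurable (measurableSet_le (hfx x) (hfx x'))).2
          (h.increasing (k + j) x x' hx)
      filter_upwards [hle] with u hu using ih hu
    rw [← h.parameterization.map_innovation_prodMk_block hX k j] at key
    exact ae_of_ae_map ((hU _).prodMk (measurable_block hU k j)).aemeasurable key

/-- As the flow preserves the order, the mean distance between the states reached from `x` and
from `x'` with the same innovations is the distance between the means. -/
lemma IsIncreasingRepresentation.lintegral_flow_sub [∀ k, IsMarkovKernel (P k)]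
    (h : IsIncreasingRepresentation X P f U μ) (hX : ∀ k, Measurable (X k)) (k : ℕ)
    {g : α k → ℝ} (hg : Measurable g) (hmono : Monotone g) {C : ℝ} (hC : ∀ y, |g y| ≤ C) (j : ℕ)
    (x x' : α (k + j)) :
    ∫⁻ b, ‖g (flow f k j x b) - g (flow f k j x' b)‖ₑ ∂(μ.map (block U k j)) =
      ‖transitionOp P k j g x - transitionOp P k j g x'‖ₑ := by
  wlog hx : x' ≤ x generalizing x x'
  · rw [← enorm_neg (transitionOp P k j g x - _), neg_sub, ← this x' x (le_of_not_ge hx)]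
    refine lintegral_congr fun b => ?_
    rw [← enorm_neg, neg_sub]
  have hprob : IsProbabilityMeasure (μ.map (block U k j)) :=
    Measure.isProbabilityMeasure_map
      (measurable_block h.parameterization.measurable k j).aemeasurable
  have hint : ∀ x, Integrable (fun b => g (flow f k j x b)) (μ.map (block U k j)) := fun x =>
    integrable_of_measurable_bound _ (hg.comp ((measurable_flow h.measurable k j).comp
      measurable_prodMk_left)) fun b => hC _
  have hle := h.flow_le hX k j hx
  have hnonneg : 0 ≤ᵐ[μ.map (block U k j)]
      fun b => g (flow f k j x b) - g (flow f k j x' b) := by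
    filter_upwards [hle] with b hb using sub_nonneg.2 (hmono hb)
  rw [← h.integral_flow hX k hg hC j x, ← h.integral_flow hX k hg hC j x',
    ← integral_sub (hint x) (hint x'),
    Real.enorm_of_nonneg (integral_nonneg_of_ae hnonneg),
    ofReal_integral_eq_lintegral_ofReal (f := fun b => g (flow f k j x b) - g (flow f k j x' b))
      ((hint x).sub (hint x')) hnonneg]
  refine lintegral_congr_ae ?_
  filter_upwards [hnonneg] with b hb using Real.enorm_of_nonneg hb

/-- If the past is asymptotically of no use for predicting `g (X k)`, then `g (X k)` is
approximated in mean by functions of finitely many innovations: start the flow from a suitable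
deterministic state in the remote past. -/
lemma IsIncreasingRepresentation.exists_lintegral_sub_flow_le [∀ k, IsMarkovKernel (P k)]
    (h : IsIncreasingRepresentation X P f U μ) (hX : ∀ k, Measurable (X k)) (k : ℕ)
    {g : α k → ℝ} (hg : Measurable g) (hmono : Monotone g) {C : ℝ} (hC : ∀ y, |g y| ≤ C) (j : ℕ)
    (c : ℝ) :
    ∃ y : α (k + j), ∫⁻ ω, ‖g (flow f k j y (block U k j ω)) - g (X k ω)‖ₑ ∂μ ≤
      2 * ∫⁻ x, ‖transitionOp P k j g x - c‖ₑ ∂(μ.map (X (k + j))) := by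
  have hU := h.parameterization.measurable
  have hT : Measurable (transitionOp P k j g) := measurable_transitionOp hg j
  have hprob : IsProbabilityMeasure (μ.map (X (k + j))) :=
    Measure.isProbabilityMeasure_map (hX (k + j)).aemeasurable
  have hprob' : IsProbabilityMeasure (μ.map (block U k j)) :=
    Measure.isProbabilityMeasure_map (measurable_block hU k j).aemeasurable
  have hTc : Measurable fun x => ‖transitionOp P k j g x - c‖ₑ := (hT.sub_const c).enorm
  -- a state `y` at which the deviation from `c` does not exceed its mean
  obtain ⟨y, hy⟩ := exists_le_lintegral (μ := μ.map (X (k + j))) hTc.aemeasurable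
  have hm : Measurable fun p : α (k + j) × (∀ i : Fin j, E (k + i)) =>
      ‖g (flow f k j y p.2) - g (flow f k j p.1 p.2)‖ₑ := by
    have h₁ : Measurable fun p : α (k + j) × (∀ i : Fin j, E (k + i)) => flow f k j p.1 p.2 :=
      measurable_flow h.measurable k j
    have h₂ : Measurable fun p : α (k + j) × (∀ i : Fin j, E (k + i)) => flow f k j y p.2 :=
      (measurable_flow h.measurable k j).comp (measurable_const.prodMk measurable_snd)
    exact ((hg.comp h₂).sub (hg.comp h₁)).enorm
  refine ⟨y, ?_⟩
  calc ∫⁻ ω, ‖g (flow f k j y (block U k j ω)) - g (X k ω)‖ₑ ∂μ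
      = ∫⁻ ω, ‖g (flow f k j y (block U k j ω)) -
          g (flow f k j (X (k + j) ω) (block U k j ω))‖ₑ ∂μ := by
        refine lintegral_congr_ae ?_
        filter_upwards [h.eq_flow k j] with ω hω
        rw [← hω]
    _ = ∫⁻ p, ‖g (flow f k j y p.2) - g (flow f k j p.1 p.2)‖ₑ
          ∂((μ.map (X (k + j))).prod (μ.map (block U k j))) := by
        rw [← h.parameterization.map_state_prodMk_block hX k j,
          lintegral_map hm ((hX _).prodMk (measurable_block hU k j))]
    _ = ∫⁻ x, ‖transitionOp P k j g y - transitionOp P k j g x‖ₑ ∂(μ.map (X (k + j))) := by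
        rw [lintegral_prod _ hm.aemeasurable]
        exact lintegral_congr fun x => h.lintegral_flow_sub hX k hg hmono hC j y x
    _ ≤ ∫⁻ x, (‖transitionOp P k j g y - c‖ₑ + ‖transitionOp P k j g x - c‖ₑ)
          ∂(μ.map (X (k + j))) := by
        refine lintegral_mono fun x => ?_
        rw [← enorm_neg (transitionOp P k j g x - c), neg_sub,
          ← sub_add_sub_cancel (transitionOp P k j g y) c]
        exact enorm_add_le _ _
    _ ≤ 2 * ∫⁻ x, ‖transitionOp P k j g x - c‖ₑ ∂(μ.map (X (k + j))) := by
        rw [lintegral_add_right _ hTc, two_mul]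
        refine add_le_add ?_ le_rfl
        simpa using hy

lemma exists_measurable_ae_eq_of_tendsto {Ω : Type*} {m mΩ : MeasurableSpace Ω} (hm : m ≤ mΩ)
    {μ : Measure Ω} {g : Ω → ℝ} (hg : Measurable[mΩ] g) {h : ℕ → Ω → ℝ}
    (hh : ∀ j, Measurable[m] (h j))
    (hlim : Tendsto (fun j => ∫⁻ ω, ‖h j ω - g ω‖ₑ ∂μ) atTop (𝓝 0)) :
    ∃ g', Measurable[m] g' ∧ g =ᵐ[μ] g' := by
  have hmeas : TendstoInMeasure μ h atTop g := by
    refine tendstoInMeasure_of_tendsto_eLpNorm one_ne_zero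
      (fun j => ((hh j).mono hm le_rfl).aestronglyMeasurable) hg.aestronglyMeasurable ?_
    simpa only [eLpNorm_one_eq_lintegral_enorm, Pi.sub_apply] using hlim
  obtain ⟨ns, -, hns⟩ := hmeas.exists_seq_tendsto_ae
  refine ⟨fun ω => limsup (fun i => h (ns i) ω) atTop,
    @Measurable.limsup _ _ _ _ _ m _ _ _ _ fun i => hh (ns i), ?_⟩
  filter_upwards [hns] with ω hω using hω.limsup_eq.symm

lemma IsIncreasingRepresentation.aele_comap_of_tendsto [∀ k, IsMarkovKernel (P k)]
    (h : IsIncreasingRepresentation X P f U μ) (hX : ∀ k, Measurable (X k)) (k : ℕ)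
    [StandardBorelSpace (α k)]
    {g : α k → ℝ} (hg : Measurable g) (hmono : StrictMono g) {C : ℝ} (hC : ∀ y, |g y| ≤ C)
    {c : ℝ} (hlim : Tendsto (fun j => ∫⁻ x, ‖transitionOp P k j g x - c‖ₑ ∂(μ.map (X (k + j))))
      atTop (𝓝 0)) :
    AELE (MeasurableSpace.comap (X k) inferInstance) (natFiltration U k) μ := by
  have hU := h.parameterization.measurable
  choose y hy using fun j => h.exists_lintegral_sub_flow_le hX k hg hmono.monotone hC j c
  have hlim' : Tendsto (fun j => ∫⁻ ω, ‖g (flow f k j (y j) (block U k j ω)) - g (X k ω)‖ₑ ∂μ)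
      atTop (𝓝 0) := by
    refine tendsto_of_tendsto_of_tendsto_of_le_of_le tendsto_const_nhds ?_
      (fun _ => zero_le) hy
    simpa using ENNReal.Tendsto.const_mul hlim (Or.inr (by norm_num : (2 : ENNReal) ≠ ⊤))
  obtain ⟨g', hg', hgg'⟩ := exists_measurable_ae_eq_of_tendsto (natFiltration_le U hU k)
    (hg.comp (hX k)) (fun j => (hg.comp ((measurable_flow h.measurable k j).comp
      measurable_prodMk_left)).comp (measurable_block_natFiltration U k j)) hlim'
  -- as `g` is a Borel isomorphism onto its image, `X k` and `g (X k)` generate the same `σ`-field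
  have hemb : MeasurableEmbedding g := hg.measurableEmbedding hmono.injective
  rintro _ ⟨B, hB, rfl⟩
  refine ⟨g' ⁻¹' (g '' B), hg' (hemb.measurableSet_image.2 hB), ?_⟩
  have := hgg'.preimage (g '' B)
  rwa [Set.preimage_comp, hmono.injective.preimage_image] at this

end Coupling

/-! ### Conditional laws given the tail `σ`-field -/

lemma condDistrib_ae_eq_map_of_indepFun {Ω β : Type*} {mΩ : MeasurableSpace Ω}
    {mβ : MeasurableSpace β} {μ : Measure Ω} [IsProbabilityMeasure μ] {T : Ω → β} {Y : Ω → ℝ}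
    (hT : Measurable T) (hY : Measurable Y) (h : IndepFun T Y μ) :
    ∀ᵐ ω ∂μ, condDistrib Y T μ (T ω) = μ.map Y := by
  have : IsProbabilityMeasure (μ.map Y) := Measure.isProbabilityMeasure_map hY.aemeasurable
  have hcond := condDistrib_ae_eq_of_measure_eq_compProd T hY.aemeasurable
    (κ := Kernel.const β (μ.map Y)) (by
      rw [(indepFun_iff_map_prod_eq_prod_map_map hT.aemeasurable hY.aemeasurable).1 h,
        Measure.compProd_const])
  exact ae_of_ae_map hT.aemeasurable hcond

section CondLaw

variable {Ω : Type*} {m mΩ : MeasurableSpace Ω} {μ : Measure Ω} [IsProbabilityMeasure μ]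
  {Y : Ω → ℝ}

lemma condExp_comp_ae_eq_integral_condLaw (hm : m ≤ mΩ) (hY : Measurable Y) {g : ℝ → ℝ}
    (hg : Measurable g) {C : ℝ} (hC : ∀ y, |g y| ≤ C) :
    μ[fun ω => g (Y ω) | m] =ᵐ[μ] fun ω => ∫ y, g y ∂(condLaw m Y μ ω) := by
  have h := @condExp_ae_eq_integral_condDistrib Ω Ω ℝ ℝ _ _ _ _ mΩ μ _ id Y m _ _
    (measurable_id'' hm) hY.aemeasurable g hg.stronglyMeasurable
    (integrable_of_measurable_bound μ (hg.comp hY) fun ω => hC (Y ω))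
  rwa [MeasurableSpace.comap_id] at h

lemma condExp_comp_ae_eq_const_of_condLaw (hm : m ≤ mΩ) (hY : Measurable Y)
    (h : ∀ᵐ ω ∂μ, condLaw m Y μ ω = μ.map Y) {g : ℝ → ℝ}
    (hg : Measurable g) {C : ℝ} (hC : ∀ y, |g y| ≤ C) :
    μ[fun ω => g (Y ω) | m] =ᵐ[μ] fun _ => ∫ y, g y ∂(μ.map Y) := by
  filter_upwards [condExp_comp_ae_eq_integral_condLaw hm hY hg hC, h] with ω h₁ h₂
  rw [h₁, h₂]

/-- Conditioning on a degenerate `σ`-field does not change laws: such a `σ`-field is independent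
of every random variable. -/
lemma condLaw_ae_eq_map_of_zero_or_one (hm : m ≤ mΩ) (hY : Measurable Y)
    (h : ∀ s, MeasurableSet[m] s → μ s = 0 ∨ μ s = 1) :
    ∀ᵐ ω ∂μ, condLaw m Y μ ω = μ.map Y := by
  have hid : @Measurable Ω Ω mΩ m id := measurable_id'' hm
  have hind : @IndepFun Ω Ω ℝ mΩ m _ id Y μ := by
    rw [@IndepFun_iff_Indep Ω Ω ℝ mΩ m _ id Y μ, MeasurableSpace.comap_id, Indep_iff]
    rintro s _ hs ⟨B, hB, rfl⟩
    rcases h s hs with h0 | h1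
    · rw [h0, zero_mul, measure_mono_null Set.inter_subset_left h0]
    · have hae : ∀ᵐ ω ∂μ, ω ∈ s := (prob_compl_eq_zero_iff (hm s hs)).2 h1
      rw [h1, one_mul]
      refine measure_congr (eventuallyEq_set.2 ?_)
      filter_upwards [hae] with ω hω
      simp [hω]
  exact @condDistrib_ae_eq_map_of_indepFun Ω Ω mΩ m μ _ id Y hid hY hind

end CondLaw

section Generation

lemma IsCopy.map_eq {Ω Ω' : Type*} [MeasurableSpace Ω] [MeasurableSpace Ω'] {α : ℕ → Type*}
    [∀ k, MeasurableSpace (α k)] {X : ∀ k, Ω → α k} {μ : Measure Ω}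
    {X' : ∀ k, Ω' → α k} {μ' : Measure Ω'}
    (h : IsCopy X' μ' X μ) (k : ℕ) : μ'.map (X' k) = μ.map (X k) :=
  (h.identDistrib.comp (measurable_pi_apply k)).map_eq

variable {Ω : Type*} [mΩ : MeasurableSpace Ω] {α : ℕ → Type*} [∀ k, MeasurableSpace (α k)]
  [∀ k, StandardBorelSpace (α k)] {X : ∀ k, Ω → α k} {P : ∀ k, Kernel (α (k + 1)) (α k)}
  {μ : Measure Ω} [IsProbabilityMeasure μ]

lemma IsMarkovProcess.tendsto_lintegral_transitionOp {Ω' : Type*} [MeasurableSpace Ω']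
    {X' : ∀ k, Ω' → α k} {μ' : Measure Ω'} (hX : IsMarkovProcess X P μ)
    (hcopy : IsCopy X' μ' X μ) (k : ℕ) {g : α k → ℝ} (hg : Measurable g) {C : ℝ}
    (hC : ∀ y, |g y| ≤ C) {c : ℝ}
    (hc : μ[fun ω => g (X k ω) | tail (natFiltration X)] =ᵐ[μ] fun _ => c) :
    Tendsto (fun j => ∫⁻ x, ‖transitionOp P k j g x - c‖ₑ ∂(μ'.map (X' (k + j)))) atTop (𝓝 0) := by
  have := hX.isMarkovKernel
  have hL2 : MemLp (fun ω => g (X k ω)) 2 μ :=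
    MemLp.of_bound (hg.comp (hX.measurable k)).aestronglyMeasurable C
      (ae_of_all _ fun ω => hC (X k ω))
  have h := tendsto_lintegral_condExp_sub_const (natFiltration_antitone X)
    (natFiltration_le X hX.measurable) hL2 hc
  refine (h.comp (tendsto_add_atTop_nat k)).congr fun j => ?_
  rw [hcopy.map_eq (k + j), lintegral_map
    ((measurable_transitionOp hg j).sub_const c).enorm (hX.measurable (k + j)),
    Function.comp_apply, add_comm j k]
  refine lintegral_congr_ae ?_
  filter_upwards [hX.condExp_transitionOp k hg hC j] with ω hω
  rw [hω]

variable [∀ k, LinearOrder (α k)] [∀ k, TopologicalSpace (α k)] [∀ k, OrderClosedTopology (α k)]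
  [∀ k, SecondCountableTopology (α k)] [∀ k, OpensMeasurableSpace (α k)]

/-- If at each instant some bounded strictly increasing function of the state is unpredictable
from the tail `σ`-field, then every increasing representation is generating. -/
lemma IsMarkovProcess.everyIncreasingRepresentationGenerates (hX : IsMarkovProcess X P μ)
    {g : ∀ k, α k → ℝ} (hg : ∀ k, Measurable (g k)) (hmono : ∀ k, StrictMono (g k)) {C : ℝ}
    (hC : ∀ k y, |g k y| ≤ C) {c : ℕ → ℝ}
    (hc : ∀ k, μ[fun ω => g k (X k ω) | tail (natFiltration X)] =ᵐ[μ] fun _ => c k) :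
    EveryIncreasingRepresentationGenerates.{_, v} X P μ := by
  intro Ω' _ μ' _ X' E _ f U hcopy hrep
  have := hX.isMarkovKernel
  refine ⟨hrep.parameterization, aele_natFiltration X' (natFiltration_antitone U) fun k => ?_⟩
  exact hrep.aele_comap_of_tendsto hcopy.measurable k (hg k) (hmono k) (hC k)
    (hX.tendsto_lintegral_transitionOp hcopy k (hg k) (hC k) (hc k))

end Generation

section Predictor

variable {Ω : Type*} [mΩ : MeasurableSpace Ω] {α : ℕ → Type*} [∀ k, MeasurableSpace (α k)]
  {X : ∀ k, Ω → α k} {P : ∀ k, Kernel (α (k + 1)) (α k)}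
  {μ : Measure Ω} {g : α 0 → ℝ} {C : ℝ}

/-- Iterates of the transition operator ending at the instant `0`, indexed by the starting
instant. -/
noncomputable def predictor (P : ∀ k, Kernel (α (k + 1)) (α k)) (g : α 0 → ℝ) : ∀ k, α k → ℝ
  | 0 => g
  | k + 1 => fun x => ∫ y, predictor P g k y ∂(P k x)

lemma measurable_predictor [∀ k, IsMarkovKernel (P k)] (hg : Measurable g) (k : ℕ) :
    Measurable (predictor P g k) := by
  induction k with
  | zero => exact hg
  | succ k ih => exact measurable_integral_kernel (P k) ih

lemma abs_predictor_le [∀ k, IsMarkovKernel (P k)] (hC : ∀ y, |g y| ≤ C) (k : ℕ) (x : α k) :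
    |predictor P g k x| ≤ C := by
  induction k with
  | zero => exact hC x
  | succ k ih => exact abs_integral_le_of_bound _ ih

lemma strictMono_predictor [∀ k, LinearOrder (α k)] [∀ k, IsMarkovKernel (P k)]
    (hmono : ∀ k, IsIncreasingKernel (P k)) (hid : ∀ k, IsIdentifiableKernel (P k))
    (hg : Measurable g) (hgmono : StrictMono g) (hC : ∀ y, |g y| ≤ C) (k : ℕ) :
    StrictMono (predictor P g k) := by
  induction k with
  | zero => exact hgmono
  | succ k ih =>
    exact (hmono k).strictMono_integral (hid k) (measurable_predictor hg k) ih
      (abs_predictor_le hC k)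

lemma IsMarkovProcess.condExp_tail_predictor [∀ k, StandardBorelSpace (α k)]
    [IsProbabilityMeasure μ] (hX : IsMarkovProcess X P μ) (hg : Measurable g)
    (hC : ∀ y, |g y| ≤ C) (k : ℕ) :
    μ[fun ω => predictor P g k (X k ω) | tail (natFiltration X)] =ᵐ[μ]
      μ[fun ω => g (X 0 ω) | tail (natFiltration X)] := by
  have := hX.isMarkovKernel
  induction k with
  | zero => rfl
  | succ k ih =>
    refine EventuallyEq.trans ?_ ih
    refine (condExp_congr_ae (hX.condExp_comp k (measurable_predictor hg k)
      (abs_predictor_le hC k)).symm).trans ?_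
    exact condExp_condExp_of_le (iInf_le _ (k + 1)) (natFiltration_le X hX.measurable (k + 1))

end Predictor

/-! ### Kolmogorovian filtrations -/

section Kolmogorov

lemma isKolmogorovian_of_aele {Ω : Type*} {F G : ℕ → MeasurableSpace Ω} [MeasurableSpace Ω]
    {μ : Measure Ω} (hG : Antitone G) (h : ∀ k, AELE (F k) (G k) μ) (hK : IsKolmogorovian G μ) :
    IsKolmogorovian F μ := by
  intro s hs
  choose t ht hst using fun k => h k s (MeasurableSpace.measurableSet_iInf.1 hs k)
  obtain ⟨T, hT, hsT⟩ := exists_measurableSet_tail hG ht hst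
  rw [measure_congr hsT]
  exact hK T hT

lemma IsProductType.isKolmogorovian {Ω : Type*} {G : ℕ → MeasurableSpace Ω}
    {mΩ : MeasurableSpace Ω} {μ : Measure Ω} (h : IsProductType.{_, w} G μ) :
    IsKolmogorovian G μ := by
  obtain ⟨E, _, ε, hε, hind, rfl⟩ := h
  intro s hs
  refine measure_zero_or_one_of_measurableSet_limsup_atTop (fun k => (hε k).comap_le)
    hind.iIndep ?_
  rwa [limsup_eq_iInf_iSup_of_nat]

variable {Ω Ω' : Type*} [mΩ : MeasurableSpace Ω] [MeasurableSpace Ω'] {α : ℕ → Type*}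
  [∀ k, MeasurableSpace (α k)] {X : ∀ k, Ω → α k} {μ : Measure Ω} {X' : ∀ k, Ω' → α k}
  {μ' : Measure Ω'}

lemma natFiltration_comap {Ω Ω' : Type*} (Z : ∀ k, Ω' → α k) (T : Ω → Ω') (k : ℕ) :
    natFiltration (fun k ω => Z k (T ω)) k = MeasurableSpace.comap T (natFiltration Z k) := by
  simp only [natFiltration, MeasurableSpace.comap_iSup, MeasurableSpace.comap_comp]
  rfl

/-- Being Kolmogorovian depends only on the law of the process.  A tail event of the process is,
for each `k`, the inverse image of some event `B k` of the sequence space which depends only on the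
coordinates from `k` on; these events coincide almost surely, hence with a tail event. -/
lemma IsCopy.isKolmogorovian (h : IsCopy X' μ' X μ) (hX : ∀ k, Measurable (X k))
    (hK : IsKolmogorovian (natFiltration X') μ') : IsKolmogorovian (natFiltration X) μ := by
  let coord : ∀ k, (∀ i, α i) → α k := fun k z => z k
  have hcoord : ∀ k, Measurable (coord k) := measurable_pi_apply
  have hXs : Measurable fun ω k => X k ω := measurable_pi_lambda _ hX
  have hXs' : Measurable fun ω k => X' k ω := measurable_pi_lambda _ h.measurable
  intro s hs
  have hB : ∀ k, ∃ B, MeasurableSet[natFiltration coord k] B ∧ (fun ω k => X k ω) ⁻¹' B = s := by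
    intro k
    have hsk := MeasurableSpace.measurableSet_iInf.1 hs k
    rwa [show natFiltration X k = MeasurableSpace.comap (fun ω k => X k ω) (natFiltration coord k)
      from natFiltration_comap coord (fun ω k => X k ω) k] at hsk
  choose B hBm hBs using hB
  have hBm' : ∀ k, MeasurableSet (B k) := fun k => natFiltration_le coord hcoord k _ (hBm k)
  have hae : ∀ k, B 0 =ᵐ[μ.map fun ω k => X k ω] B k := by
    intro k
    rw [eventuallyEq_set, ae_map_iff hXs.aemeasurable]
    · refine ae_of_all _ fun ω => ?_
      change ω ∈ (fun ω k => X k ω) ⁻¹' B 0 ↔ ω ∈ (fun ω k => X k ω) ⁻¹' B k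
      rw [hBs, hBs]
    · exact MeasurableSet.iff (hBm' 0) (hBm' k)
  obtain ⟨T, hT, hBT⟩ := exists_measurableSet_tail (natFiltration_antitone coord) hBm hae
  have hTm : MeasurableSet T := tail_le coord hcoord _ hT
  have hμ : μ s = μ' ((fun ω k => X' k ω) ⁻¹' T) := by
    rw [← hBs 0, ← Measure.map_apply hXs (hBm' 0), measure_congr hBT, ← h.identDistrib.map_eq,
      Measure.map_apply hXs' hTm]
  rw [hμ]
  refine hK _ (MeasurableSpace.measurableSet_iInf.2 fun k => ?_)
  rw [show natFiltration X' k = MeasurableSpace.comap (fun ω k => X' k ω) (natFiltration coord k)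
      from natFiltration_comap coord (fun ω k => X' k ω) k]
  exact ⟨T, MeasurableSpace.measurableSet_iInf.1 hT k, rfl⟩

lemma IsStandard.isKolmogorovian (h : IsStandard.{_, v} X μ) (hX : ∀ k, Measurable (X k)) :
    IsKolmogorovian (natFiltration X) μ := by
  obtain ⟨Ω', _, μ', _, X', G, hcopy, hG, himm⟩ := h
  refine hcopy.isKolmogorovian hX (isKolmogorovian_of_aele ?_ himm.le hG.isKolmogorovian)
  obtain ⟨E, _, ε, -, -, rfl⟩ := hG
  exact natFiltration_antitone ε

end Kolmogorov

/-! ### Generating parameterizations and immersion -/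

section Immersion

variable {Ω : Type*} {mF mF' mU mG mΩ : MeasurableSpace Ω} {μ : Measure Ω} [IsProbabilityMeasure μ]

lemma setIntegral_eq_mul_of_indep {m : MeasurableSpace Ω} (hU : mU ≤ mΩ) (hm : m ≤ mΩ)
    (h : Indep mU m μ) {b : Set Ω} (hb : MeasurableSet[mU] b) {f : Ω → ℝ}
    (hf : StronglyMeasurable[m] f) (hfi : Integrable f μ) :
    ∫ ω in b, f ω ∂μ = μ.real b * ∫ ω, f ω ∂μ := by
  rw [← setIntegral_condExp hU hfi hb,
    setIntegral_congr_ae (hU b hb) ((condExp_indep_eq hm hU hf h.symm).mono fun ω hω _ => hω),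
    setIntegral_const, smul_eq_mul]

/-- Information which is independent of `mF ⊔ mG` does not help to predict an event of `mG`
from `mF`. -/
lemma condExp_sup_ae_eq_of_indep (hF : mF ≤ mΩ) (hU : mU ≤ mΩ) (hG : mG ≤ mΩ)
    (h : Indep mU (mF ⊔ mG) μ) {t : Set Ω} (ht : MeasurableSet[mG] t) :
    μ[t.indicator fun _ => (1 : ℝ) | mF ⊔ mU] =ᵐ[μ] μ[t.indicator fun _ => (1 : ℝ) | mF] := by
  have hFU : mF ⊔ mU ≤ mΩ := sup_le hF hU
  have hFG : mF ⊔ mG ≤ mΩ := sup_le hF hG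
  have hint : Integrable (t.indicator fun _ => (1 : ℝ)) μ :=
    (integrable_const 1).indicator (hG t ht)
  have hint' : Integrable (μ[t.indicator fun _ => (1 : ℝ) | mF]) μ := integrable_condExp
  refine (ae_eq_condExp_of_forall_setIntegral_eq hFU hint (fun _ _ _ => hint'.integrableOn) ?_
    ⟨_, stronglyMeasurable_condExp.mono le_sup_left, EventuallyEq.rfl⟩).symm
  intro s hs _
  refine MeasurableSpace.induction_on_inter
    (C := fun s _ => ∫ ω in s, (μ[t.indicator fun _ => (1 : ℝ) | mF]) ω ∂μ
      = ∫ ω in s, t.indicator (fun _ => (1 : ℝ)) ω ∂μ)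
    (generateFrom_interSets mF mU).symm (isPiSystem_interSets mF mU) (by simp) ?_ ?_ ?_ s hs
  · rintro _ ⟨a, b, ha, hb, rfl⟩
    have hprod : ∀ f : Ω → ℝ, StronglyMeasurable[mF ⊔ mG] f → Integrable f μ →
        ∫ ω in a ∩ b, f ω ∂μ = μ.real b * ∫ ω in a, f ω ∂μ := by
      intro f hf hfi
      have haFG : MeasurableSet[mF ⊔ mG] a := (le_sup_left : mF ≤ mF ⊔ mG) a ha
      rw [← integral_indicator (hF a ha), ← setIntegral_eq_mul_of_indep hU hFG h hb
        (hf.indicator haFG) (hfi.indicator (hF a ha)), setIntegral_indicator (hF a ha),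
        Set.inter_comm]
    rw [hprod _ (stronglyMeasurable_condExp.mono le_sup_left) hint',
      hprod _ (stronglyMeasurable_const.indicator ((le_sup_right : mG ≤ mF ⊔ mG) t ht)) hint,
      setIntegral_condExp hF hint ha]
  · intro s hs ih
    have hs' := hFU s hs
    have h₁ := integral_add_compl hs' hint
    have h₂ := integral_add_compl hs' hint'
    have h₃ := integral_condExp (f := t.indicator fun _ => (1 : ℝ)) (μ := μ) hF
    linarith
  · intro s hdisj hs ih
    have hs' : ∀ i, MeasurableSet (s i) := fun i => hFU _ (hs i)
    rw [integral_iUnion hs' hdisj hint'.integrableOn, integral_iUnion hs' hdisj hint.integrableOn]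
    exact tsum_congr ih

lemma condIndepSigma_of_indep (hF : mF ≤ mΩ) (hU : mU ≤ mΩ)
    (hG : mG ≤ mΩ) (h : Indep mU (mF ⊔ mG) μ) (h' : AELE mF' (mF ⊔ mU) μ) :
    CondIndepSigma mF mF' mG μ := by
  intro s t hs ht
  obtain ⟨s', hs', hss'⟩ := h' s hs
  have hFU : mF ⊔ mU ≤ mΩ := sup_le hF hU
  have hints : Integrable (s'.indicator fun _ => (1 : ℝ)) μ :=
    (integrable_const 1).indicator (hFU s' hs')
  have hintt : Integrable (t.indicator fun _ => (1 : ℝ)) μ :=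
    (integrable_const 1).indicator (hG t ht)
  have hbound : ∀ ω, ‖s'.indicator (fun _ => (1 : ℝ)) ω‖ ≤ 1 := fun ω =>
    (norm_indicator_le_norm_self _ ω).trans (by simp)
  have hsm : StronglyMeasurable[mF ⊔ mU] (s'.indicator fun _ => (1 : ℝ)) :=
    stronglyMeasurable_const.indicator hs'
  have hind : (s ∩ t).indicator (fun _ => (1 : ℝ)) =ᵐ[μ]
      s'.indicator (fun _ => (1 : ℝ)) * t.indicator fun _ => (1 : ℝ) := by
    filter_upwards [eventuallyEq_set.1 hss'] with ω hω
    by_cases h₁ : ω ∈ s' <;> by_cases h₂ : ω ∈ t <;> simp [hω, h₁, h₂]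
  have hind' : s.indicator (fun _ => (1 : ℝ)) =ᵐ[μ] s'.indicator fun _ => (1 : ℝ) :=
    indicator_ae_eq_of_ae_eq_set hss'
  have hint : Integrable (s'.indicator (fun _ => (1 : ℝ)) *
      μ[t.indicator fun _ => (1 : ℝ) | mF]) μ :=
    integrable_condExp.bdd_mul (hsm.mono hFU).aestronglyMeasurable (ae_of_all _ hbound)
  calc μ[(s ∩ t).indicator fun _ => (1 : ℝ) | mF]
      =ᵐ[μ] μ[s'.indicator (fun _ => (1 : ℝ)) * t.indicator fun _ => (1 : ℝ) | mF] :=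
        condExp_congr_ae hind
    _ =ᵐ[μ] μ[μ[s'.indicator (fun _ => (1 : ℝ)) * t.indicator fun _ => (1 : ℝ) | mF ⊔ mU] | mF] :=
        (condExp_condExp_of_le le_sup_left hFU).symm
    _ =ᵐ[μ] μ[s'.indicator (fun _ => (1 : ℝ)) * μ[t.indicator fun _ => (1 : ℝ) | mF] | mF] := by
        refine condExp_congr_ae ?_
        refine (condExp_stronglyMeasurable_mul_of_bound hFU hsm hintt 1
          (ae_of_all _ hbound)).trans ?_
        exact EventuallyEq.rfl.mul (condExp_sup_ae_eq_of_indep hF hU hG h ht)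
    _ =ᵐ[μ] μ[s'.indicator fun _ => (1 : ℝ) | mF] * μ[t.indicator fun _ => (1 : ℝ) | mF] :=
        condExp_mul_of_stronglyMeasurable_right stronglyMeasurable_condExp hint hints
    _ =ᵐ[μ] μ[s.indicator fun _ => (1 : ℝ) | mF] * μ[t.indicator fun _ => (1 : ℝ) | mF] :=
        (condExp_congr_ae hind'.symm).mul EventuallyEq.rfl

end Immersion

lemma AdmitsGeneratingParameterization.isStandard {Ω : Type*} [MeasurableSpace Ω]
    {α : ℕ → Type*} [∀ k, MeasurableSpace (α k)] {X : ∀ k, Ω → α k} {μ : Measure Ω}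
    (h : AdmitsGeneratingParameterization.{_, v} X μ) : IsStandard.{_, v} X μ := by
  obtain ⟨Ω', _, μ', _, X', E, _, U, hcopy, hU⟩ := h
  refine ⟨Ω', _, μ', inferInstance, X', natFiltration U, hcopy,
    ⟨E, _, U, hU.measurable, hU.toIsParameterization.iIndepFun, rfl⟩, hU.generating, fun k => ?_⟩
  exact condIndepSigma_of_indep (natFiltration_le X' hcopy.measurable (k + 1))
    (hU.measurable k).comap_le (natFiltration_le U hU.measurable (k + 1)) (hU.indep k) (hU.le k)

/-! ### Monotone updating functions -/

section Quantile

open unitInterval Set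

/-- The quantile functions of a kernel on the unit interval: they represent the kernel, and they
are ordered whenever the distribution functions are. -/
lemma exists_monotone_map_eq_unitInterval {β : Type*} [MeasurableSpace β] (κ : Kernel β I)
    [IsMarkovKernel κ] :
    ∃ f : β → I → I, Measurable (Function.uncurry f) ∧ (∀ a, volume.map (f a) = κ a) ∧
      ∀ a a', (∀ x, (κ a').real (Iic x) ≤ (κ a).real (Iic x)) → ∀ t, f a t ≤ f a' t := by
  let f := fun a (t : I) => sSup {x | (κ a).real (Iic x) < t}
  have hmono : ∀ a, Monotone fun x => (κ a).real (Iic x) := fun a x y hxy =>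
    measureReal_mono (Iic_subset_Iic.2 hxy)
  have hf : Measurable (Function.uncurry f) := by
    refine measurable_of_Ioi fun c => ?_
    have hset : Function.uncurry f ⁻¹' Ioi c = ⋃ (q : ℚ) (hq : (q : ℝ) ∈ I) (_ : (c : ℝ) < q),
        {e : β × I | (κ e.1).real (Iic ⟨q, hq⟩) < e.2} := by
      ext e
      simp only [mem_preimage, Function.uncurry, mem_Ioi, f, lt_sSup_iff, mem_iUnion, exists_prop]
      constructor
      · rintro ⟨y, hy, hcy⟩
        obtain ⟨q, hcq, hqy⟩ := exists_rat_btwn (Subtype.coe_lt_coe.2 hcy)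
        exact ⟨q, ⟨c.2.1.trans hcq.le, hqy.le.trans y.2.2⟩, hcq,
          lt_of_le_of_lt (hmono e.1 (Subtype.coe_le_coe.1 hqy.le)) hy⟩
      · rintro ⟨q, hq, hcq, h⟩
        exact ⟨⟨q, hq⟩, h, hcq⟩
    rw [hset]
    refine MeasurableSet.iUnion fun q => MeasurableSet.iUnion fun hq =>
      MeasurableSet.iUnion fun _ => measurableSet_lt ?_ measurable_snd.subtype_val
    exact ((κ.measurable_coe measurableSet_Iic).comp measurable_fst).ennreal_toReal
  refine ⟨f, hf, fun a => ?_, fun a a' h t => sSup_le_sSup fun x hx => (h x).trans_lt hx⟩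
  have hfa : Measurable (f a) := hf.comp measurable_prodMk_left
  refine (volume.map (f a)).ext_of_Iic (κ a) fun x => ?_
  have hmem : (κ a).real (Iic x) ∈ I := ⟨measureReal_nonneg, measureReal_le_one⟩
  have hset : f a ⁻¹' Iic x = Iic ⟨(κ a).real (Iic x), hmem⟩ := by
    ext t
    simp only [mem_preimage, mem_Iic]
    constructor
    · intro ht
      change (t : ℝ) ≤ (κ a).real (Iic x)
      rcases eq_or_ne x 1 with rfl | hx
      · rw [show Iic (1 : I) = univ from eq_univ_of_forall fun y => y.2.2, probReal_univ]
        exact t.2.2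
      -- right continuity of the distribution function at `x`
      have hneBot : NeBot (𝓝[>] x) :=
        nhdsGT_neBot_of_exists_gt ⟨1, lt_of_le_of_ne x.2.2 hx⟩
      have hcont : Tendsto (fun y => (κ a).real (Iic y)) (𝓝[>] x) (𝓝 ((κ a).real (Iic x))) := by
        have hIcc : ∀ y : I, Iic y = Icc 0 y := fun y => by ext z; simp
        simp_rw [hIcc, ← unitInterval.cdf_eq_real (κ a)]
        have hright := continuousWithinAt_Ioi_iff_Ici.mpr
          ((cdf ((κ a).map Subtype.val)).right_continuous x)
        exact hright.tendsto.comp (tendsto_nhdsWithin_of_tendsto_nhds_of_eventually_within _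
          (continuous_subtype_val.continuousWithinAt.tendsto)
          (eventually_nhdsWithin_of_forall fun y hy => hy))
      refine ge_of_tendsto hcont (eventually_nhdsWithin_of_forall fun y hy => ?_)
      by_contra! hlt
      have hy' : y ≤ f a t := le_sSup hlt
      exact absurd (hy'.trans ht) (not_le.2 (show x < y from hy))
    · intro ht
      refine sSup_le fun y hy => ?_
      by_contra! hxy
      have h₁ : (κ a).real (Iic x) ≤ (κ a).real (Iic y) := hmono a hxy.le
      have h₂ : (κ a).real (Iic y) < t := hy
      have h₃ : (t : ℝ) ≤ (κ a).real (Iic x) := ht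
      linarith
  rw [Measure.map_apply hfa measurableSet_Iic, hset, unitInterval.volume_Iic]
  exact ofReal_measureReal

variable {β γ : Type*} [MeasurableSpace β] [MeasurableSpace γ] [StandardBorelSpace γ]

/-- An increasing kernel has updating functions which are almost surely increasing: transport the
quantile functions through an increasing embedding `g` into the unit interval.  Their values are in
the range of `g` only almost surely; elsewhere the inverse of `g` takes an arbitrary value. -/
lemma IsIncreasingKernel.exists_increasing_map_eq [LE β] [LinearOrder γ] [Nonempty γ]
    {κ : Kernel β γ} [IsMarkovKernel κ] (hκ : IsIncreasingKernel κ) {g : γ → I} (hg : Measurable g)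
    (hgmono : StrictMono g) :
    ∃ f : β → I → γ, Measurable (Function.uncurry f) ∧ (∀ x, volume.map (f x) = κ x) ∧
      ∀ x x', x ≤ x' → ∀ᵐ u ∂(volume : Measure I), f x u ≤ f x' u := by
  have hemb : MeasurableEmbedding g := hg.measurableEmbedding hgmono.injective
  have hinv : Measurable hemb.invFun := hemb.measurable_invFun
  have hmark : IsMarkovKernel (κ.map g) := Kernel.IsMarkovKernel.map κ hg
  obtain ⟨f, hf, hlaw, hmono⟩ := exists_monotone_map_eq_unitInterval (κ.map g)
  have hfx : ∀ x, Measurable (f x) := fun x => hf.comp measurable_prodMk_left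
  refine ⟨fun x u => hemb.invFun (f x u), hinv.comp hf, fun x => ?_, fun x x' hx => ?_⟩
  · change volume.map (hemb.invFun ∘ f x) = κ x
    rw [← Measure.map_map hinv (hfx x), hlaw, Kernel.map_apply _ hg, Measure.map_map hinv hg,
      hemb.leftInverse_invFun.comp_eq_id, Measure.map_id]
  · have hrange : ∀ x, ∀ᵐ u, f x u ∈ range g := fun x => by
      refine ae_of_ae_map (hfx x).aemeasurable ?_
      rw [hlaw, Kernel.map_apply _ hg]
      exact (ae_map_iff hg.aemeasurable hemb.measurableSet_range).2 (ae_of_all _ mem_range_self)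
    have hle : ∀ u, f x u ≤ f x' u := by
      refine hmono x x' fun y => ?_
      obtain ⟨π, h₁, h₂, hπ⟩ := hκ x x' hx
      have hB : MeasurableSet (g ⁻¹' Iic y) := hg measurableSet_Iic
      rw [measureReal_def, measureReal_def, Kernel.map_apply' _ hg _ measurableSet_Iic,
        Kernel.map_apply' _ hg _ measurableSet_Iic, ← h₁, ← h₂,
        Measure.map_apply measurable_snd hB, Measure.map_apply measurable_fst hB]
      have : IsProbabilityMeasure (π.map Prod.fst) := h₁ ▸ inferInstance
      have : IsProbabilityMeasure π := Measure.isProbabilityMeasure_of_map Prod.fst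
      refine ENNReal.toReal_mono (measure_ne_top _ _) (measure_mono_ae ?_)
      filter_upwards [hπ] with p hp hp₂
      exact (hgmono.monotone hp).trans hp₂
    filter_upwards [hrange x, hrange x'] with u hu hu'
    obtain ⟨y, hy⟩ := hu
    obtain ⟨y', hy'⟩ := hu'
    have h := hle u
    rw [← hy, ← hy'] at h ⊢
    rw [hemb.leftInverse_invFun, hemb.leftInverse_invFun]
    exact hgmono.le_iff_le.1 h

/-- If `Y = f x u` with `u` uniform, then `u` can be recovered in law from `Y` and an independent
uniform variable, by sampling from the conditional law of `u` given `Y`. -/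
lemma exists_inverse_sampling {κ : Kernel β γ} [IsMarkovKernel κ] {f : β → I → γ}
    (hf : Measurable (Function.uncurry f)) (hlaw : ∀ x, volume.map (f x) = κ x) :
    ∃ φ : β → γ → I → I, (Measurable fun p : β × γ × I => φ p.1 p.2.1 p.2.2) ∧
      ∀ x, ((κ x).prod volume).map (fun p => (p.1, φ x p.1 p.2)) =
        volume.map fun u => (f x u, u) := by
  have hjoint : Measurable fun p : β × I => (f p.1 p.2, p.2) := hf.prodMk measurable_snd
  -- the joint law of `(f x u, u)`, to be disintegrated along its first component
  let η : Kernel β (γ × I) := (Kernel.id ×ₖ Kernel.const β volume).map fun p => (f p.1 p.2, p.2)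
  have hη : ∀ x, η x = volume.map fun u => (f x u, u) := fun x => by
    rw [Kernel.map_apply _ hjoint, Kernel.prod_apply, Kernel.id_apply, Kernel.const_apply,
      Measure.dirac_prod, Measure.map_map hjoint measurable_prodMk_left]
    rfl
  have hmark : IsMarkovKernel η := Kernel.IsMarkovKernel.map _ hjoint
  have hfst : η.fst = κ := by
    ext1 x
    have hm : Measurable fun u => (f x u, u) :=
      (hf.comp measurable_prodMk_left).prodMk measurable_id
    rw [Kernel.fst_apply, hη, Measure.map_map measurable_fst hm, ← hlaw]
    rfl
  obtain ⟨φ, hφ, hφlaw⟩ := Kernel.exists_measurable_map_eq_unitInterval η.condKernel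
  refine ⟨fun x y v => φ (x, y) v, ?_, fun x => ?_⟩
  · exact hφ.comp ((measurable_fst.prodMk measurable_snd.fst).prodMk measurable_snd.snd)
  · have hφx : Measurable fun p : γ × I => (p.1, φ (x, p.1) p.2) :=
      measurable_fst.prodMk (hφ.comp ((measurable_const.prodMk measurable_fst).prodMk
        measurable_snd))
    rw [← hη, ← η.disintegrate η.condKernel, hfst]
    ext S hS
    rw [Measure.map_apply hφx hS, Measure.prod_apply (hφx hS), Kernel.compProd_apply hS]
    refine lintegral_congr fun y => ?_
    have hm : Measurable (φ (x, y)) := hφ.comp measurable_prodMk_left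
    rw [← hφlaw, Measure.map_apply hm (measurable_prodMk_left hS)]
    rfl

end Quantile

/-! ### Existence of increasing representations -/

section Sampling

open unitInterval

/-- A process `X` with the law of a Markov process with transition kernels `P`, an independent
sequence `V` of independent uniform variables, updating functions `f` of the kernels `P`, and
functions `φ` which sample the uniform variable used by `f` given the two ends of a transition. -/
structure IsSamplingScheme {Ω : Type*} [MeasurableSpace Ω] {α : ℕ → Type*}
    [∀ k, MeasurableSpace (α k)] (X : ∀ k, Ω → α k) (P : ∀ k, Kernel (α (k + 1)) (α k))
    (V : ℕ → Ω → I) (f : ∀ k, α (k + 1) → I → α k) (φ : ∀ k, α (k + 1) → α k → I → I)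
    (μ : Measure Ω) : Prop where
  measurable : ∀ k, Measurable (X k)
  transition : ∀ k, μ.map (fun ω => (past X (k + 1) ω, X k ω)) =
    μ.map (past X (k + 1)) ⊗ₘ pastKernel P k
  measurable_uniform : ∀ k, Measurable (V k)
  map_uniform : ∀ k, μ.map (V k) = volume
  iIndepFun_uniform : iIndepFun V μ
  indep : Indep (natFiltration X 0) (natFiltration V 0) μ
  measurable_update : ∀ k, Measurable (Function.uncurry (f k))
  measurable_sample : ∀ k, Measurable fun p : α (k + 1) × α k × I => φ k p.1 p.2.1 p.2.2
  map_sample : ∀ k x, ((P k x).prod volume).map (fun p => (p.1, φ k x p.1 p.2)) =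
    volume.map fun u => (f k x u, u)

variable {Ω : Type*} [mΩ : MeasurableSpace Ω] {α : ℕ → Type*} [∀ k, MeasurableSpace (α k)]
  {X : ∀ k, Ω → α k} {P : ∀ k, Kernel (α (k + 1)) (α k)} {μ : Measure Ω}
  {V : ℕ → Ω → I} {f : ∀ k, α (k + 1) → I → α k} {φ : ∀ k, α (k + 1) → α k → I → I}

/-- The innovation sampled from a transition of the process and an auxiliary uniform variable. -/
def innovation (X : ∀ k, Ω → α k) (V : ℕ → Ω → I) (φ : ∀ k, α (k + 1) → α k → I → I) (k : ℕ)
    (ω : Ω) : I :=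
  φ k (X (k + 1) ω) (X k ω) (V k ω)

lemma IsSamplingScheme.measurable_innovation (h : IsSamplingScheme X P V f φ μ) (k : ℕ) :
    Measurable (innovation X V φ k) :=
  (h.measurable_sample k).comp
    ((h.measurable (k + 1)).prodMk ((h.measurable k).prodMk (h.measurable_uniform k)))

variable [IsProbabilityMeasure μ] [∀ k, IsMarkovKernel (P k)]

/-- The sampled innovation is uniform and independent of the past, and it drives the
transition. -/
lemma IsSamplingScheme.map_past_state_innovation (h : IsSamplingScheme X P V f φ μ) (k : ℕ) :
    μ.map (fun ω => (past X (k + 1) ω, X k ω, innovation X V φ k ω)) =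
      ((μ.map (past X (k + 1))).prod volume).map fun p => (p.1, f k (p.1 0) p.2, p.2) := by
  obtain ⟨hX, hP, hV, hVlaw, -, hXV, hf, hφ, hfφ⟩ := h
  have hpast := measurable_past X hX (k + 1)
  have hprob : IsProbabilityMeasure (μ.map (past X (k + 1))) :=
    Measure.isProbabilityMeasure_map hpast.aemeasurable
  have hpair : Measurable fun ω => (past X (k + 1) ω, X k ω) := hpast.prodMk (hX k)
  have hz0 : Measurable fun z : ∀ i, α (k + 1 + i) => (z 0 : α (k + 1)) := measurable_pi_apply 0
  have hT' : Measurable fun p : ((∀ i, α (k + 1 + i)) × α k) × I =>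
      ((p.1.1 0 : α (k + 1)), p.1.2, p.2) :=
    (hz0.comp measurable_fst.fst).prodMk (measurable_fst.snd.prodMk measurable_snd)
  have hT : Measurable fun p : ((∀ i, α (k + 1 + i)) × α k) × I =>
      (p.1.1, p.1.2, φ k (p.1.1 0) p.1.2 p.2) :=
    measurable_fst.fst.prodMk (measurable_fst.snd.prodMk ((hφ k).comp hT'))
  have hR' : Measurable fun p : (∀ i, α (k + 1 + i)) × I => ((p.1 0 : α (k + 1)), p.2) :=
    (hz0.comp measurable_fst).prodMk measurable_snd
  have hR : Measurable fun p : (∀ i, α (k + 1 + i)) × I => (p.1, f k (p.1 0) p.2, p.2) :=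
    measurable_fst.prodMk (((hf k).comp hR').prodMk measurable_snd)
  have hind : IndepFun (fun ω => (past X (k + 1) ω, X k ω)) (V k) μ := by
    rw [IndepFun_iff_Indep]
    refine indep_of_indep_of_le hXV ?_ (comap_le_natFiltration V (Nat.zero_le k))
    rw [← measurable_iff_comap_le]
    have hpast₀ : Measurable[natFiltration X 0] (past X (k + 1)) :=
      @measurable_pi_lambda _ _ _ (natFiltration X 0) _ _
        fun i => measurable_natFiltration X (Nat.zero_le _)
    have hXk₀ : Measurable[natFiltration X 0] (X k) :=
      measurable_natFiltration X (Nat.zero_le k)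
    exact hpast₀.prodMk hXk₀
  have hlaw : μ.map (fun ω => ((past X (k + 1) ω, X k ω), V k ω)) =
      (μ.map (past X (k + 1)) ⊗ₘ pastKernel P k).prod volume := by
    rw [(indepFun_iff_map_prod_eq_prod_map_map hpair.aemeasurable (hV k).aemeasurable).1 hind,
      hP k, hVlaw k]
  have hleft : μ.map (fun ω => (past X (k + 1) ω, X k ω, innovation X V φ k ω)) =
      ((μ.map (past X (k + 1)) ⊗ₘ pastKernel P k).prod volume).map
        fun p => (p.1.1, p.1.2, φ k (p.1.1 0) p.1.2 p.2) := by
    rw [← hlaw, Measure.map_map hT (hpair.prodMk (hV k))]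
    rfl
  rw [hleft]
  ext S hS
  rw [Measure.map_apply hT hS, Measure.map_apply hR hS, Measure.prod_apply (hT hS),
    Measure.prod_apply (hR hS), Measure.lintegral_compProd
      (measurable_measure_prodMk_left (hT hS))]
  refine lintegral_congr fun z => ?_
  have hz : MeasurableSet (Prod.mk z ⁻¹' S) := measurable_prodMk_left hS
  have hφz : Measurable fun p : α k × I => (p.1, φ k (z 0) p.1 p.2) :=
    measurable_fst.prodMk ((hφ k).comp (measurable_const.prodMk measurable_id))
  have hfz : Measurable fun u => (f k (z 0) u, u) :=
    ((hf k).comp measurable_prodMk_left).prodMk measurable_id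
  have h := congrArg (fun ν => ν (Prod.mk z ⁻¹' S)) (hfφ k (z 0))
  rw [Measure.map_apply hφz hz, Measure.map_apply hfz hz, Measure.prod_apply (hφz hz)] at h
  exact h

lemma measurable_update_past (hf : ∀ k, Measurable (Function.uncurry (f k))) (k : ℕ) :
    Measurable fun p : (∀ i, α (k + 1 + i)) × I => f k (p.1 0) p.2 := by
  have hz0 : Measurable fun z : ∀ i, α (k + 1 + i) => (z 0 : α (k + 1)) := measurable_pi_apply 0
  exact (hf k).comp ((hz0.comp measurable_fst).prodMk measurable_snd)

lemma IsSamplingScheme.map_innovation (h : IsSamplingScheme X P V f φ μ) (k : ℕ) :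
    μ.map (innovation X V φ k) = volume := by
  have hpast := measurable_past X h.measurable (k + 1)
  have hprob : IsProbabilityMeasure (μ.map (past X (k + 1))) :=
    Measure.isProbabilityMeasure_map hpast.aemeasurable
  have hR := measurable_fst.prodMk ((measurable_update_past h.measurable_update k).prodMk
    measurable_snd)
  have key := congrArg (Measure.map fun p => p.2.2) (h.map_past_state_innovation k)
  rw [Measure.map_map measurable_snd.snd
      (hpast.prodMk ((h.measurable k).prodMk (h.measurable_innovation k))),
    Measure.map_map measurable_snd.snd hR] at key
  change μ.map (innovation X V φ k) = ((μ.map (past X (k + 1))).prod volume).map Prod.snd at key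
  rw [key, Measure.map_snd_prod, measure_univ, one_smul]

lemma IsSamplingScheme.ae_eq_update [∀ k, MeasurableEq (α k)] (h : IsSamplingScheme X P V f φ μ)
    (k : ℕ) : ∀ᵐ ω ∂μ, X k ω = f k (X (k + 1) ω) (innovation X V φ k ω) := by
  have hpast := measurable_past X h.measurable (k + 1)
  have hup := measurable_update_past h.measurable_update k
  have hR := measurable_fst.prodMk (hup.prodMk measurable_snd)
  have hset : MeasurableSet {p : (∀ i, α (k + 1 + i)) × α k × I | p.2.1 = f k (p.1 0) p.2.2} :=
    measurableSet_eq_fun measurable_snd.fst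
      (hup.comp (measurable_fst.prodMk measurable_snd.snd))
  have key : ∀ᵐ p ∂(μ.map fun ω => (past X (k + 1) ω, X k ω, innovation X V φ k ω)),
      p.2.1 = f k (p.1 0) p.2.2 := by
    rw [h.map_past_state_innovation k]
    exact (ae_map_iff hR.aemeasurable hset).2 (ae_of_all _ fun p => rfl)
  exact ae_of_ae_map
    (hpast.prodMk ((h.measurable k).prodMk (h.measurable_innovation k))).aemeasurable key

lemma IsSamplingScheme.indepFun_past_innovation (h : IsSamplingScheme X P V f φ μ) (k : ℕ) :
    IndepFun (past X (k + 1)) (innovation X V φ k) μ := by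
  have hpast := measurable_past X h.measurable (k + 1)
  have hprob : IsProbabilityMeasure (μ.map (past X (k + 1))) :=
    Measure.isProbabilityMeasure_map hpast.aemeasurable
  have hR := measurable_fst.prodMk ((measurable_update_past h.measurable_update k).prodMk
    measurable_snd)
  have hproj : Measurable fun p : (∀ i, α (k + 1 + i)) × α k × I => (p.1, p.2.2) :=
    measurable_fst.prodMk measurable_snd.snd
  rw [indepFun_iff_map_prod_eq_prod_map_map hpast.aemeasurable
    (h.measurable_innovation k).aemeasurable, h.map_innovation k]
  have key := congrArg (Measure.map fun p => (p.1, p.2.2)) (h.map_past_state_innovation k)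
  rw [Measure.map_map hproj (hpast.prodMk ((h.measurable k).prodMk (h.measurable_innovation k))),
    Measure.map_map hproj hR] at key
  exact key.trans Measure.map_id

lemma IsSamplingScheme.indep_innovation (h : IsSamplingScheme X P V f φ μ) (k : ℕ) :
    Indep (MeasurableSpace.comap (innovation X V φ k) inferInstance)
      (natFiltration X (k + 1) ⊔ natFiltration V (k + 1)) μ := by
  have hX := natFiltration_le X h.measurable
  have hV := natFiltration_le V h.measurable_uniform
  have hVk := (h.measurable_uniform k).comap_le
  have hVtail : Indep (MeasurableSpace.comap (V k) inferInstance) (natFiltration V (k + 1)) μ := by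
    have := indep_iSup_of_disjoint (fun j => (h.measurable_uniform j).comap_le)
      h.iIndepFun_uniform.iIndep (S := {k}) (T := {j | k + 1 ≤ j})
      (by simp)
    rw [iSup_singleton] at this
    exact this
  -- the whole of `X` together with `V k` is independent of the earlier auxiliary variables
  have h₁ : Indep (natFiltration X 0 ⊔ MeasurableSpace.comap (V k) inferInstance)
      (natFiltration V (k + 1)) μ :=
    indep_sup_left (hX 0) hVk (hV (k + 1)) (indep_of_indep_of_le_right h.indep
      (sup_le (comap_le_natFiltration V (Nat.zero_le k))
        (natFiltration_antitone V (Nat.zero_le _)))) hVtail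
  have hinn : MeasurableSpace.comap (innovation X V φ k) inferInstance ≤
      natFiltration X 0 ⊔ MeasurableSpace.comap (V k) inferInstance := by
    rw [← measurable_iff_comap_le]
    have hXm : ∀ j, Measurable[natFiltration X 0 ⊔ MeasurableSpace.comap (V k) inferInstance]
        (X j) := fun j =>
      (measurable_natFiltration X (Nat.zero_le j)).mono le_sup_left le_rfl
    have hVm : Measurable[natFiltration X 0 ⊔ MeasurableSpace.comap (V k) inferInstance] (V k) :=
      (comap_measurable (V k)).mono le_sup_right le_rfl
    exact (h.measurable_sample k).comp ((hXm (k + 1)).prodMk ((hXm k).prodMk hVm))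
  have h₂ : Indep (natFiltration X (k + 1))
      (MeasurableSpace.comap (innovation X V φ k) inferInstance) μ := by
    rw [natFiltration_eq_comap_past]
    exact (IndepFun_iff_Indep _ _ _).1 (h.indepFun_past_innovation k)
  have h₃ := indep_sup_left (hV (k + 1)) (hX (k + 1)) (h.measurable_innovation k).comap_le
    (indep_of_indep_of_le_right h₁.symm
      (sup_le ((natFiltration_antitone X (Nat.zero_le _)).trans le_sup_left) hinn)) h₂
  rw [sup_comm]
  exact h₃.symm

/-- The updating functions and the sampled innovations form an increasing representation.  The
innovations are lifted to an arbitrary universe. -/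
lemma IsSamplingScheme.isIncreasingRepresentation [∀ k, MeasurableEq (α k)] [∀ k, LE (α k)]
    (h : IsSamplingScheme X P V f φ μ)
    (hlaw : ∀ k x, volume.map (f k x) = P k x)
    (hmono : ∀ k x x', x ≤ x' → ∀ᵐ u ∂(volume : Measure I), f k x u ≤ f k x' u) :
    IsIncreasingRepresentation X P (fun k x (e : ULift.{v} I) => f k x e.down)
      (fun k ω => ULift.up.{v} (innovation X V φ k ω)) μ := by
  have hUm := fun k => measurable_up.comp (h.measurable_innovation k)
  have hcomap : ∀ k, MeasurableSpace.comap (fun ω => ULift.up.{v} (innovation X V φ k ω))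
      inferInstance ≤ MeasurableSpace.comap (innovation X V φ k) inferInstance := fun k => by
    rw [← measurable_iff_comap_le]
    exact measurable_up.comp (comap_measurable _)
  have hfx : ∀ k x, Measurable (f k x) := fun k x =>
    (h.measurable_update k).comp measurable_prodMk_left
  refine ⟨⟨hUm, fun k => ?_, fun k => ?_⟩, fun k => ?_, fun k x => ?_, fun k x x' hx => ?_, fun k =>
    h.ae_eq_update k⟩
  · refine indep_of_indep_of_le (h.indep_innovation k) (hcomap k) (sup_le le_sup_left ?_)
    refine iSup₂_le fun j hj => ?_
    rw [← measurable_iff_comap_le]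
    have hXm : ∀ i, k + 1 ≤ i →
        Measurable[natFiltration X (k + 1) ⊔ natFiltration V (k + 1)] (X i) := fun i hi =>
      (measurable_natFiltration X hi).mono le_sup_left le_rfl
    have hVm : Measurable[natFiltration X (k + 1) ⊔ natFiltration V (k + 1)] (V j) :=
      (measurable_natFiltration V hj).mono le_sup_right le_rfl
    exact measurable_up.comp ((h.measurable_sample j).comp
      ((hXm (j + 1) (hj.trans j.le_succ)).prodMk ((hXm j hj).prodMk hVm)))
  · rw [aele_iff, natFiltration_eq_sup X k]
    refine sup_le (aele_iff.1 (aele_of_le μ le_sup_left))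
      (aele_iff.1 (aele_comap_of_ae_eq ?_ (h.ae_eq_update k)))
    have hXm : Measurable[natFiltration X (k + 1) ⊔ MeasurableSpace.comap
        (fun ω => ULift.up.{v} (innovation X V φ k ω)) inferInstance] (X (k + 1)) :=
      (measurable_natFiltration X le_rfl).mono le_sup_left le_rfl
    have hUm : Measurable[natFiltration X (k + 1) ⊔ MeasurableSpace.comap
        (fun ω => ULift.up.{v} (innovation X V φ k ω)) inferInstance] (innovation X V φ k) :=
      (measurable_down.comp (comap_measurable fun ω => ULift.up.{v} (innovation X V φ k ω))).mono
        le_sup_right le_rfl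
    exact (h.measurable_update k).comp (hXm.prodMk hUm)
  · exact (h.measurable_update k).comp (measurable_fst.prodMk (measurable_down.comp measurable_snd))
  · have hfd : Measurable fun e : ULift.{v} I => f k x e.down := (hfx k x).comp measurable_down
    have hUk : Measurable fun ω => ULift.up.{v} (innovation X V φ k ω) := hUm k
    rw [Measure.map_map hfd hUk, ← hlaw k x, ← h.map_innovation k,
      Measure.map_map (hfx k x) (h.measurable_innovation k)]
    rfl
  · have key := hmono k x x' hx
    rw [← h.map_innovation k] at key
    exact ae_of_ae_map (h.measurable_innovation k).aemeasurable key

end Sampling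

section Construction

open unitInterval

/-- The probability space which carries a copy of `X` and an independent sequence of independent
uniform variables. -/
lemma exists_copy_with_uniforms {Ω : Type*} [MeasurableSpace Ω] {α : ℕ → Type}
    [∀ k, MeasurableSpace (α k)] {X : ∀ k, Ω → α k} {μ : Measure Ω} [IsProbabilityMeasure μ]
    (hX : ∀ k, Measurable (X k)) :
    ∃ (Ω' : Type v) (_ : MeasurableSpace Ω') (μ' : Measure Ω') (_ : IsProbabilityMeasure μ')
      (X' : ∀ k, Ω' → α k) (V : ℕ → Ω' → I), IsCopy X' μ' X μ ∧ (∀ k, Measurable (V k)) ∧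
        (∀ k, μ'.map (V k) = volume) ∧ iIndepFun V μ' ∧
        Indep (natFiltration X' 0) (natFiltration V 0) μ' := by
  have hXs : Measurable fun ω k => X k ω := measurable_pi_lambda _ hX
  let law : Measure (∀ k, α k) := μ.map fun ω k => X k ω
  let unif : Measure (ℕ → I) := Measure.infinitePi fun _ => volume
  have hlaw : IsProbabilityMeasure law := Measure.isProbabilityMeasure_map hXs.aemeasurable
  let μ' : Measure (ULift.{v} ((∀ k, α k) × (ℕ → I))) := (law.prod unif).map ULift.up
  have hμ' : IsProbabilityMeasure μ' := Measure.isProbabilityMeasure_map measurable_up.aemeasurable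
  have hfst : Measurable fun ω : ULift.{v} ((∀ k, α k) × (ℕ → I)) => ω.down.1 :=
    measurable_fst.comp measurable_down
  have hsnd : Measurable fun ω : ULift.{v} ((∀ k, α k) × (ℕ → I)) => ω.down.2 :=
    measurable_snd.comp measurable_down
  have hmapfst : μ'.map (fun ω => ω.down.1) = law := by
    rw [Measure.map_map hfst measurable_up]
    exact (Measure.map_fst_prod (μ := law) (ν := unif)).trans (by simp)
  have hmapsnd : μ'.map (fun ω => ω.down.2) = unif := by
    rw [Measure.map_map hsnd measurable_up]
    exact (Measure.map_snd_prod (μ := law) (ν := unif)).trans (by simp)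
  have hV : ∀ k, Measurable fun ω : ULift.{v} ((∀ k, α k) × (ℕ → I)) => ω.down.2 k := fun k =>
    (measurable_pi_apply k).comp hsnd
  have hVlaw : ∀ k, μ'.map (fun ω => ω.down.2 k) = volume := fun k => by
    rw [← Measure.infinitePi_map_eval (fun _ : ℕ => (volume : Measure I)) k]
    change _ = unif.map _
    rw [← hmapsnd, Measure.map_map (measurable_pi_apply k) hsnd]
    rfl
  refine ⟨_, _, μ', hμ', fun k ω => ω.down.1 k, fun k ω => ω.down.2 k,
    ⟨fun k => (measurable_pi_apply k).comp hfst, hfst.aemeasurable, hXs.aemeasurable, hmapfst⟩,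
    hV, hVlaw, ?_, ?_⟩
  · rw [iIndepFun_iff_map_fun_eq_infinitePi_map hV]
    simp_rw [hVlaw]
    exact hmapsnd
  · rw [natFiltration_eq_comap_past, natFiltration_eq_comap_past]
    have hind : IndepFun (fun ω : ULift.{v} ((∀ k, α k) × (ℕ → I)) => ω.down.1)
        (fun ω => ω.down.2) μ' := by
      rw [indepFun_iff_map_prod_eq_prod_map_map hfst.aemeasurable hsnd.aemeasurable, hmapfst,
        hmapsnd, Measure.map_map (hfst.prodMk hsnd) measurable_up]
      exact Measure.map_id
    have h₁ : Measurable (past (fun k (z : ∀ k, α k) => z k) 0) :=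
      measurable_past _ measurable_pi_apply 0
    have h₂ : Measurable (past (fun k (z : ℕ → I) => z k) 0) :=
      measurable_past _ measurable_pi_apply 0
    exact (IndepFun_iff_Indep _ _ _).1 (hind.comp h₁ h₂)

end Construction

/-! ### The equivalences -/

lemma IsCopy.map_past_prodMk {Ω Ω' : Type*} [MeasurableSpace Ω] [MeasurableSpace Ω']
    {α : ℕ → Type*} [∀ k, MeasurableSpace (α k)] {X : ∀ k, Ω → α k} {μ : Measure Ω}
    [IsProbabilityMeasure μ] {P : ∀ k, Kernel (α (k + 1)) (α k)} {X' : ∀ k, Ω' → α k}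
    {μ' : Measure Ω'} (h : IsCopy X' μ' X μ) (hX : IsMarkovProcess X P μ) (k : ℕ) :
    μ'.map (fun ω => (past X' (k + 1) ω, X' k ω)) =
      μ'.map (past X' (k + 1)) ⊗ₘ pastKernel P k := by
  have hpast : Measurable (past (fun k (z : ∀ k, α k) => z k) (k + 1)) :=
    measurable_past _ measurable_pi_apply (k + 1)
  have h₁ := (h.identDistrib.comp (hpast.prodMk (measurable_pi_apply k))).map_eq
  have h₂ := (h.identDistrib.comp hpast).map_eq
  have h₃ := hX.map_past_prodMk k
  change μ'.map (fun ω => (past X' (k + 1) ω, X' k ω)) =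
    μ.map (fun ω => (past X (k + 1) ω, X k ω)) at h₁
  change μ'.map (past X' (k + 1)) = μ.map (past X (k + 1)) at h₂
  rw [h₁, h₂, h₃]

section Main

variable {Ω : Type u} [MeasurableSpace Ω] {μ : Measure Ω} [IsProbabilityMeasure μ]
  {A : ℕ → Set ℝ} {X : ∀ k, Ω → A k} {P : ∀ k, Kernel (A (k + 1)) (A k)}

lemma IsMarkovProcess.exists_isIncreasingRepresentation (hX : IsMarkovProcess X P μ)
    (hA : ∀ k, MeasurableSet (A k)) (hmono : ∀ k, IsIncreasingKernel (P k)) :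
    ∃ (Ω' : Type v) (_ : MeasurableSpace Ω') (μ' : Measure Ω') (_ : IsProbabilityMeasure μ')
      (X' : ∀ k, Ω' → A k) (E : ℕ → Type v) (_ : ∀ k, MeasurableSpace (E k))
      (f : ∀ k, A (k + 1) → E k → A k) (U : ∀ k, Ω' → E k),
      IsCopy X' μ' X μ ∧ IsIncreasingRepresentation X' P f U μ' := by
  have := hX.isMarkovKernel
  have hstd : ∀ k, StandardBorelSpace (A k) := fun k => (hA k).standardBorel
  obtain ⟨ω₀⟩ := nonempty_of_isProbabilityMeasure μ
  have hne : ∀ k, Nonempty (A k) := fun k => ⟨X k ω₀⟩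
  choose f hf hflaw hfmono using fun k => (hmono k).exists_increasing_map_eq
    (g := fun x : A k => unitInterval.sigmoid x)
    (unitInterval.continuous_sigmoid.measurable.comp measurable_subtype_coe)
    (fun x y h => unitInterval.sigmoid_strictMono h)
  choose φ hφ hφlaw using fun k => exists_inverse_sampling (hf k) (hflaw k)
  obtain ⟨Ω', _, μ', _, X', V, hcopy, hV, hVlaw, hVind, hXV⟩ :=
    exists_copy_with_uniforms.{v} (α := fun k => A k) (μ := μ) hX.measurable
  have hs : IsSamplingScheme X' P V f φ μ' :=
    ⟨hcopy.measurable, hcopy.map_past_prodMk hX, hV, hVlaw, hVind, hXV, hf, hφ, hφlaw⟩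
  exact ⟨Ω', _, μ', inferInstance, X', _, _, _, _, hcopy,
    hs.isIncreasingRepresentation.{v} hflaw hfmono⟩

lemma EveryIncreasingRepresentationGenerates.admitsGeneratingParameterization
    (h : EveryIncreasingRepresentationGenerates.{u, v, 0} X P μ) (hX : IsMarkovProcess X P μ)
    (hA : ∀ k, MeasurableSet (A k)) (hmono : ∀ k, IsIncreasingKernel (P k)) :
    AdmitsGeneratingParameterization.{u, v, 0} X μ := by
  obtain ⟨Ω', _, μ', _, X', E, _, f, U, hcopy, hrep⟩ :=
    hX.exists_isIncreasingRepresentation.{u, v} hA hmono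
  exact ⟨Ω', _, μ', inferInstance, X', E, _, U, hcopy,
    h Ω' _ μ' inferInstance X' E _ f U hcopy hrep⟩

lemma abs_sigmoid_le_one (x : ℝ) : |Real.sigmoid x| ≤ 1 := by
  rw [abs_of_nonneg (Real.sigmoid_nonneg x)]
  exact Real.sigmoid_le_one x

lemma IsMarkovProcess.everyIncreasingRepresentationGenerates_of_condLaw
    (hX : IsMarkovProcess X P μ) (hA : ∀ k, MeasurableSet (A k))
    (h : ∀ n, ∀ᵐ ω ∂μ, condLaw (tail (natFiltration X)) (fun ω' => (X n ω' : ℝ)) μ ω =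
      μ.map (fun ω' => (X n ω' : ℝ))) :
    EveryIncreasingRepresentationGenerates.{u, v, 0} X P μ := by
  have hstd : ∀ k, StandardBorelSpace (A k) := fun k => (hA k).standardBorel
  exact hX.everyIncreasingRepresentationGenerates (g := fun k x => Real.sigmoid x)
    (fun _ => continuous_sigmoid.measurable.comp measurable_subtype_coe)
    (fun _ _ _ hxy => Real.sigmoid_strictMono hxy) (fun _ y => abs_sigmoid_le_one y)
    fun k => condExp_comp_ae_eq_const_of_condLaw (tail_le X hX.measurable)
      (measurable_subtype_coe.comp (hX.measurable k)) (h k) continuous_sigmoid.measurable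
      abs_sigmoid_le_one

lemma IsMarkovProcess.everyIncreasingRepresentationGenerates_of_isIdentifiable
    (hX : IsMarkovProcess X P μ) (hA : ∀ k, MeasurableSet (A k))
    (hmono : ∀ k, IsIncreasingKernel (P k)) (hid : ∀ k, IsIdentifiableKernel (P k))
    (h : ∀ᵐ ω ∂μ, condLaw (tail (natFiltration X)) (fun ω' => (X 0 ω' : ℝ)) μ ω =
      μ.map (fun ω' => (X 0 ω' : ℝ))) :
    EveryIncreasingRepresentationGenerates.{u, v, 0} X P μ := by
  have := hX.isMarkovKernel
  have hstd : ∀ k, StandardBorelSpace (A k) := fun k => (hA k).standardBorel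
  have hg : Measurable fun x : A 0 => Real.sigmoid x :=
    continuous_sigmoid.measurable.comp measurable_subtype_coe
  have hC : ∀ x : A 0, |Real.sigmoid x| ≤ 1 := fun x => abs_sigmoid_le_one x
  exact hX.everyIncreasingRepresentationGenerates
    (measurable_predictor hg)
    (strictMono_predictor hmono hid hg (fun x y hxy => Real.sigmoid_strictMono hxy) hC)
    (abs_predictor_le hC)
    fun k => (hX.condExp_tail_predictor hg hC k).trans
      (condExp_comp_ae_eq_const_of_condLaw (tail_le X hX.measurable)
        (measurable_subtype_coe.comp (hX.measurable 0)) h continuous_sigmoid.measurable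
        abs_sigmoid_le_one)

lemma IsMarkovProcess.condLaw_ae_eq_map_of_isKolmogorovian (hX : IsMarkovProcess X P μ)
    (h : IsKolmogorovian (natFiltration X) μ) (n : ℕ) :
    ∀ᵐ ω ∂μ, condLaw (tail (natFiltration X)) (fun ω' => (X n ω' : ℝ)) μ ω =
      μ.map (fun ω' => (X n ω' : ℝ)) :=
  condLaw_ae_eq_map_of_zero_or_one (tail_le X hX.measurable)
    (measurable_subtype_coe.comp (hX.measurable n)) h

end Main

end NegTime

theorem theorem3p6 {Ω : Type u} [MeasurableSpace Ω] (μ : Measure Ω) [IsProbabilityMeasure μ]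
    (A : ℕ → Set ℝ) (hA : ∀ k, MeasurableSet (A k))
    (X : ∀ k, Ω → A k) (P : ∀ k, Kernel (A (k + 1)) (A k))
    (hX : NegTime.IsMarkovProcess X P μ)
    (hmono : ∀ k, NegTime.IsIncreasingKernel (P k)) :
    List.TFAE
      [NegTime.IsStandard.{u, v, 0} X μ,
       NegTime.AdmitsGeneratingParameterization.{u, v, 0} X μ,
       NegTime.EveryIncreasingRepresentationGenerates.{u, v, 0} X P μ,
       ∀ n, ∀ᵐ ω ∂μ, NegTime.condLaw (NegTime.tail (NegTime.natFiltration X))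
          (fun ω' => (X n ω' : ℝ)) μ ω = μ.map (fun ω' => (X n ω' : ℝ)),
       NegTime.IsKolmogorovian (NegTime.natFiltration X) μ] ∧
    ((∀ k, NegTime.IsIdentifiableKernel (P k)) →
      List.TFAE
        [NegTime.IsStandard.{u, v, 0} X μ,
         NegTime.AdmitsGeneratingParameterization.{u, v, 0} X μ,
         NegTime.EveryIncreasingRepresentationGenerates.{u, v, 0} X P μ,
         ∀ n, ∀ᵐ ω ∂μ, NegTime.condLaw (NegTime.tail (NegTime.natFiltration X))
            (fun ω' => (X n ω' : ℝ)) μ ω = μ.map (fun ω' => (X n ω' : ℝ)),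
         NegTime.IsKolmogorovian (NegTime.natFiltration X) μ,
         ∀ᵐ ω ∂μ, NegTime.condLaw (NegTime.tail (NegTime.natFiltration X))
            (fun ω' => (X 0 ω' : ℝ)) μ ω = μ.map (fun ω' => (X 0 ω' : ℝ))]) := by
  have h₁₅ := fun h : NegTime.IsStandard.{u, v, 0} X μ => h.isKolmogorovian hX.measurable
  have h₅₄ := hX.condLaw_ae_eq_map_of_isKolmogorovian
  have h₄₃ := hX.everyIncreasingRepresentationGenerates_of_condLaw.{u, v} hA
  have h₃₂ := fun h : NegTime.EveryIncreasingRepresentationGenerates.{u, v, 0} X P μ =>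
    h.admitsGeneratingParameterization hX hA hmono
  have h₂₁ := fun h : NegTime.AdmitsGeneratingParameterization.{u, v, 0} X μ => h.isStandard
  refine ⟨?_, fun hid => ?_⟩
  · tfae_have 1 → 5 := h₁₅
    tfae_have 5 → 4 := h₅₄
    tfae_have 4 → 3 := h₄₃
    tfae_have 3 → 2 := h₃₂
    tfae_have 2 → 1 := h₂₁
    tfae_finish
  · tfae_have 1 → 5 := h₁₅
    tfae_have 5 → 4 := h₅₄
    tfae_have 4 → 6 := fun h => h 0
    tfae_have 6 → 3 :=
      hX.everyIncreasingRepresentationGenerates_of_isIdentifiable.{u, v} hA hmono hid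
    tfae_have 3 → 2 := h₃₂
    tfae_have 2 → 1 := h₂₁
    tfae_finish
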